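/- Let $M$ be a compact (Hausdorff) smooth manifold. A complex structure on $M$ is a smooth endomorphism field $J$ of $TM$ with $J^2=-\mathrm{Id}$ that is integrable, i.e. $[JX,JY]=[X,Y]+J[JX,Y]+J[X,JY]$ for all smooth vector fields $X,Y$. Write $\Omega^k(M,\mathbb C)=\bigoplus_{p+q=k}\Omega^{p,q}_J(M)$ for the induced bigrading of the smooth complex-valued $k$-forms, $\pi^{p,q}$ for the projections onto its summands, and $d=\partial+\bar\partial$ for the corresponding decomposition of the exterior derivative. A complex symplectic form on $(M,J)$ is a closed non-degenerate form in $\Omega^{2,0}_J(M)$, and $(M,J)$ is called complex symplectic if it carries one. Let $H^{p,q}_J(M)\subseteq H^{p+q}_{\mathrm{dR}}(M;\mathbb C)$ be the subspace of the classes that can be represented by a closed form in $\Omega^{p,q}_J(M)$; $(M,J)$ is complex-$\mathcal C^\infty$-full at the second stage if $$H^2_{\mathrm{dR}}(M;\mathbb C)=H^{2,0}_J(M)+H^{1,1}_J(M)+H^{0,2}_J(M).$$ For a closed form $\omega\in\Omega^2(M,\mathbb C)$ and $X=(M,J)$ let $$\Delta(X,\omega)=\bigl\{\gamma\in\Omega^1(M,\mathbb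 C)\ :\ d\gamma=\omega-(\alpha^{2,0}+\alpha^{1,1}+\alpha^{0,2})\text{ for some closed }\alpha^{p,q}\in\Omega^{p,q}_J(M)\bigr\}.$$ **Theorem.** Let $\varepsilon>0$ and let $X_t=(M,J_t)$, $t\in(-\varepsilon,\varepsilon)$, be a differentiable family of compact complex manifolds, that is, each $J_t$ is a complex structure on $M$ and $J_t$ depends smoothly on $(t,x)\in(-\varepsilon,\varepsilon)\times M$. Let $\omega_{\mathbb C}$ be a complex symplectic form on $X_0=(M,J_0)$. Suppose that for every $t\neq0$ the manifold $X_t$ is complex-$\mathcal C^\infty$-full at the second stage and that there is $\gamma_t\in\Delta(X_t,\omega_{\mathbb C})$ with $$\partial_t\bar\partial_t\bigl(\pi^{1,0}_t(\gamma_t)\bigr)=0,$$ where $\partial_t,\bar\partial_t,\pi_t^{p,q}$ are taken with respect to $J_t$. Then there is $0<\delta\le\varepsilon$ such that for all $|t|<\delta$ the manifold $X_t$ is complex symplectic; more precisely, the $(2,0)$-part $\pi^{2,0}_t(\omega_{\mathbb C})$ of $\omega_{\mathbb C}$ with respect to $J_t$ is a complex symplectic form on $X_t$. -/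

import Mathlib

open scoped Manifold ContDiff Topology

noncomputable section

namespace CplxSympl

/-! ### Linear algebra: the bigrading of complex-valued alternating forms on `(V, J)` -/

section LinearAlgebra

variable {V : Type*} [AddCommGroup V] [Module ℝ V] [TopologicalSpace V] {k : ℕ}

/-- The form `σ` with `J` inserted in the slots belonging to `S`:
`(v₁, …, v_k) ↦ σ(w₁, …, w_k)`, where `w_i = J v_i` for `i ∈ S` and `w_i = v_i` otherwise. -/
def insertJ (J : V →L[ℝ] V) (S : Finset (Fin k)) (σ : V [⋀^Fin k]→L[ℝ] ℂ) :
    ContinuousMultilinearMap ℝ (fun _ : Fin k => V) ℂ :=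
  σ.toContinuousMultilinearMap.compContinuousLinearMap
    (fun i => if i ∈ S then J else ContinuousLinearMap.id ℝ V)

/-- Put `v^{1,0} = (v - iJv)/2` and `v^{0,1} = (v + iJv)/2` in the complexification of `V`. The
value at `(v₁, …, v_k)` is `σ_ℂ(Z₁, …, Z_k)`, where `σ_ℂ` is the complex-multilinear extension of
`σ`, and `Z_j = v_j^{1,0}` for `j ∈ A`, `Z_j = v_j^{0,1}` for `j ∉ A`; the sum over `S` is the
expansion of this expression by multilinearity. -/
def slotPart (J : V →L[ℝ] V) (A : Finset (Fin k)) (σ : V [⋀^Fin k]→L[ℝ] ℂ) :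
    ContinuousMultilinearMap ℝ (fun _ : Fin k => V) ℂ :=
  ∑ S : Finset (Fin k),
    ((∏ i : Fin k, (1 / 2 : ℂ) *
      (if i ∈ S then (if i ∈ A then -Complex.I else Complex.I) else 1)) : ℂ) • insertJ J S σ

/-- The form `σ` is of type `(p,q)`: its complex-multilinear extension vanishes on every tuple of
vectors of type `(1,0)` or `(0,1)`, unless exactly `p` of them have type `(1,0)` and exactly `q`
have type `(0,1)`. -/
def IsType (J : V →L[ℝ] V) (p q : ℕ) (σ : V [⋀^Fin k]→L[ℝ] ℂ) : Prop :=
  ∀ A : Finset (Fin k), ¬ (A.card = p ∧ Aᶜ.card = q) → slotPart J A σ = 0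

/-- The sum of `slotPart J A σ` over those `A` that have `p` elements, and `q` elements in the
complement. -/
def typePartAux (J : V →L[ℝ] V) (p q : ℕ) (σ : V [⋀^Fin k]→L[ℝ] ℂ) :
    ContinuousMultilinearMap ℝ (fun _ : Fin k => V) ℂ :=
  ∑ A : Finset (Fin k), (if A.card = p ∧ Aᶜ.card = q then (1 : ℂ) else 0) • slotPart J A σ

theorem insertJ_swap (J : V →L[ℝ] V) (S : Finset (Fin k)) (σ : V [⋀^Fin k]→L[ℝ] ℂ)
    (v : Fin k → V) (i j : Fin k) (hv : v i = v j) (hij : i ≠ j) :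
    insertJ J (S.map (Equiv.swap i j).toEmbedding) σ v = - insertJ J S σ v := by
  have key : (fun l => (if l ∈ S.map (Equiv.swap i j).toEmbedding then J
        else ContinuousLinearMap.id ℝ V) (v l)) =
      (fun l => (if l ∈ S then J else ContinuousLinearMap.id ℝ V) (v l)) ∘ Equiv.swap i j := by
    funext l
    have hl : v (Equiv.swap i j l) = v l := by
      rcases eq_or_ne l i with rfl | h1
      · simp [hv]
      rcases eq_or_ne l j with rfl | h2
      · simp [hv]
      · rw [Equiv.swap_apply_of_ne_of_ne h1 h2]
    have hm : l ∈ S.map (Equiv.swap i j).toEmbedding ↔ Equiv.swap i j l ∈ S := by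
      rw [Finset.mem_map_equiv, Equiv.symm_swap]
    simp only [Function.comp, hl, hm]
  have h := σ.toAlternatingMap.map_swap
    (fun l => (if l ∈ S then J else ContinuousLinearMap.id ℝ V) (v l)) hij
  rw [← key] at h
  exact h

theorem typePartAux_eq_zero (J : V →L[ℝ] V) (p q : ℕ) (σ : V [⋀^Fin k]→L[ℝ] ℂ)
    (v : Fin k → V) (i j : Fin k) (hv : v i = v j) (hij : i ≠ j) :
    typePartAux J p q σ v = 0 := by
  classical
  let e : Finset (Fin k) ≃ Finset (Fin k) := (Equiv.swap i j).finsetCongr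
  have he : ∀ S, e S = S.map (Equiv.swap i j).toEmbedding := fun S => rfl
  have hm : ∀ (S : Finset (Fin k)) l, Equiv.swap i j l ∈ e S ↔ l ∈ S := by
    intro S l
    rw [he, Finset.mem_map_equiv, Equiv.symm_swap, Equiv.swap_apply_self]
  have hc : ∀ S : Finset (Fin k), (e S).card = S.card := fun S => by
    rw [he, Finset.card_map]
  have hslot : ∀ A, slotPart J (e A) σ v = - slotPart J A σ v := by
    intro A
    simp only [slotPart, sum_apply, smul_apply]
    rw [← e.sum_comp, ← Finset.sum_neg_distrib]
    refine Finset.sum_congr rfl fun S _ => ?_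
    rw [he S, insertJ_swap J S σ v i j hv hij, smul_neg, ← he S]
    congr 2
    rw [← Equiv.prod_comp (Equiv.swap i j)]
    simp only [hm]
  have hneg : typePartAux J p q σ v = - typePartAux J p q σ v := by
    simp only [typePartAux, sum_apply,
      smul_apply]
    conv_lhs => rw [← e.sum_comp]
    rw [← Finset.sum_neg_distrib]
    refine Finset.sum_congr rfl fun A _ => ?_
    rw [hslot, smul_neg, Finset.card_compl, Finset.card_compl, hc]
  exact self_eq_neg.mp hneg

/-- The projection `π^{p,q}` onto the component of type `(p,q)`; it is zero on `k`-forms with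
`k ≠ p + q`. -/
def typePart (J : V →L[ℝ] V) (p q : ℕ) (σ : V [⋀^Fin k]→L[ℝ] ℂ) : V [⋀^Fin k]→L[ℝ] ℂ where
  toContinuousMultilinearMap := typePartAux J p q σ
  map_eq_zero_of_eq' := fun v i j hv hij => typePartAux_eq_zero J p q σ v i j hv hij

end LinearAlgebra

/-! ### Complex-valued differential forms on a manifold -/

section Forms

variable (E : Type*) [NormedAddCommGroup E] [NormedSpace ℝ E]
  (M : Type*) [TopologicalSpace M] [ChartedSpace E M]

/-- Complex-valued differential `k`-forms on `M`, without any regularity. -/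
def CForm (k : ℕ) : Type _ := (x : M) → TangentSpace 𝓘(ℝ, E) x [⋀^Fin k]→L[ℝ] ℂ

instance (k : ℕ) : AddCommGroup (CForm E M k) :=
  inferInstanceAs (AddCommGroup ((x : M) → TangentSpace 𝓘(ℝ, E) x [⋀^Fin k]→L[ℝ] ℂ))

instance (k : ℕ) : Module ℂ (CForm E M k) where
  smul c σ := fun x => c • σ x
  one_smul σ := funext fun x => ContinuousAlternatingMap.ext fun v => one_mul (σ x v)
  mul_smul c c' σ := funext fun x => ContinuousAlternatingMap.ext fun v => mul_assoc c c' (σ x v)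
  smul_zero c := funext fun _ => ContinuousAlternatingMap.ext fun _ => mul_zero c
  smul_add c σ τ := funext fun x => ContinuousAlternatingMap.ext fun v =>
    mul_add c (σ x v) (τ x v)
  add_smul c c' σ := funext fun x => ContinuousAlternatingMap.ext fun v =>
    add_mul c c' (σ x v)
  zero_smul σ := funext fun x => ContinuousAlternatingMap.ext fun v => zero_mul (σ x v)

variable {E M} {k : ℕ}

/-- The coordinate expression of `σ` in the preferred chart at `x₀`: the pullback of `σ` under the
inverse of the chart. -/
def CForm.inChart (σ : CForm E M k) (x₀ : M) (y : E) : E [⋀^Fin k]→L[ℝ] ℂ :=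
  (σ ((chartAt E x₀).symm y)).compContinuousLinearMap
    (mfderiv 𝓘(ℝ, E) 𝓘(ℝ, E) (chartAt E x₀).symm y)

/-- A form is smooth when all its coordinate expressions are. -/
def CForm.IsSmooth (σ : CForm E M k) : Prop :=
  ∀ x₀ : M, ContDiffOn ℝ ∞ (σ.inChart x₀) (chartAt E x₀).target

/-- The exterior derivative, computed at each point in the preferred chart at that point. -/
def CForm.d (σ : CForm E M k) : CForm E M (k + 1) := fun x =>
  (extDeriv (σ.inChart x) (chartAt E x x)).compContinuousLinearMap
    (mfderiv 𝓘(ℝ, E) 𝓘(ℝ, E) (chartAt E x) x)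

/-- A form is closed when its exterior derivative vanishes. -/
def CForm.IsClosed (σ : CForm E M k) : Prop := σ.d = 0

theorem CForm.inChart_add (σ η : CForm E M k) (x₀ : M) :
    CForm.inChart (σ + η) x₀ = σ.inChart x₀ + η.inChart x₀ := rfl

theorem CForm.inChart_smul (c : ℂ) (σ : CForm E M k) (x₀ : M) :
    CForm.inChart (c • σ) x₀ = c • σ.inChart x₀ := rfl

theorem CForm.inChart_zero (x₀ : M) : CForm.inChart (0 : CForm E M k) x₀ = 0 := rfl

theorem CForm.IsSmooth.differentiableAt {σ : CForm E M k} (h : σ.IsSmooth) (x : M) :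
    DifferentiableAt ℝ (σ.inChart x) (chartAt E x x) :=
  ((h x).contDiffAt ((chartAt E x).open_target.mem_nhds
    (mem_chart_target E x))).differentiableAt (by simp)

theorem CForm.d_add {σ η : CForm E M k} (hσ : σ.IsSmooth) (hη : η.IsSmooth) :
    CForm.d (σ + η) = σ.d + η.d := by
  funext x
  simp only [CForm.d, CForm.inChart_add,
    extDeriv_add (hσ.differentiableAt x) (hη.differentiableAt x)]
  rfl

theorem CForm.d_smul (c : ℂ) {σ : CForm E M k} (hσ : σ.IsSmooth) :
    CForm.d (c • σ) = c • σ.d := by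
  funext x
  have h : extDeriv (c • σ.inChart x) (chartAt E x x) =
      c • extDeriv (σ.inChart x) (chartAt E x x) := by
    have h1 : fderiv ℝ (c • σ.inChart x) (chartAt E x x) =
        c • fderiv ℝ (σ.inChart x) (chartAt E x x) :=
      fderiv_const_smul (hσ.differentiableAt x) c
    ext v
    simp only [extDeriv, h1, ContinuousAlternatingMap.smul_apply,
      ContinuousAlternatingMap.alternatizeUncurryFin_apply, Finset.smul_sum]
    refine Finset.sum_congr rfl fun i _ => ?_
    rw [smul_comm c]
    rfl
  simp only [CForm.d, CForm.inChart_smul, h]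
  rfl

theorem CForm.d_zero : CForm.d (0 : CForm E M k) = 0 := by
  funext x
  ext v
  have h : extDeriv (0 : E → E [⋀^Fin k]→L[ℝ] ℂ) (chartAt E x x) = 0 := by
    ext w
    simp [extDeriv, ContinuousAlternatingMap.alternatizeUncurryFin_apply]
  simp only [CForm.d, CForm.inChart_zero, h]
  rfl

variable (E M)

/-- `Ω^k(M, ℂ)`, the space of smooth complex-valued `k`-forms. -/
def smoothForms (k : ℕ) : Submodule ℂ (CForm E M k) where
  carrier := {σ | σ.IsSmooth}
  add_mem' := fun hσ hη x₀ => (hσ x₀).add (hη x₀)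
  zero_mem' := fun _ => contDiffOn_const (c := (0 : E [⋀^Fin k]→L[ℝ] ℂ))
  smul_mem' := fun c _ hσ x₀ => (hσ x₀).const_smul c

/-- The space of smooth closed complex-valued `k`-forms. -/
def closedForms (k : ℕ) : Submodule ℂ (CForm E M k) where
  carrier := {σ | σ ∈ smoothForms E M k ∧ σ.IsClosed}
  add_mem' := fun {σ η} hσ hη => ⟨add_mem hσ.1 hη.1, by
    rw [CForm.IsClosed, CForm.d_add hσ.1 hη.1, hσ.2, hη.2, add_zero]⟩
  zero_mem' := ⟨zero_mem _, CForm.d_zero⟩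
  smul_mem' := fun c σ hσ => ⟨Submodule.smul_mem _ c hσ.1, by
    rw [CForm.IsClosed, CForm.d_smul c hσ.1, hσ.2, smul_zero]⟩

/-- The space `d Ω^{k-1}(M, ℂ)` of exact complex-valued `k`-forms (zero for `k = 0`). -/
def exactForms : (k : ℕ) → Submodule ℂ (CForm E M k)
  | 0 => ⊥
  | k + 1 =>
    { carrier := {σ | ∃ η ∈ smoothForms E M k, σ = η.d}
      add_mem' := by
        rintro _ _ ⟨η, hη, rfl⟩ ⟨θ, hθ, rfl⟩
        exact ⟨η + θ, add_mem hη hθ, (CForm.d_add hη hθ).symm⟩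
      zero_mem' := ⟨0, zero_mem _, CForm.d_zero.symm⟩
      smul_mem' := by
        rintro c _ ⟨η, hη, rfl⟩
        exact ⟨c • η, Submodule.smul_mem _ c hη, (CForm.d_smul c hη).symm⟩ }

/-- De Rham cohomology `H^k_dR(M; ℂ)`: closed forms modulo exact forms. -/
abbrev DeRham (k : ℕ) : Type _ :=
  closedForms E M k ⧸ (exactForms E M k).comap (closedForms E M k).subtype

end Forms

/-! ### Complex structures -/

section Complex

variable (E : Type*) [NormedAddCommGroup E] [NormedSpace ℝ E]
  (M : Type*) [TopologicalSpace M] [ChartedSpace E M]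

/-- Fields of endomorphisms of the tangent bundle, without any regularity. -/
abbrev EndField : Type _ := (x : M) → TangentSpace 𝓘(ℝ, E) x →L[ℝ] TangentSpace 𝓘(ℝ, E) x

variable {E M} {k : ℕ}

/-- Smoothness of a vector field. -/
def IsSmoothVectorField (X : (x : M) → TangentSpace 𝓘(ℝ, E) x) [IsManifold 𝓘(ℝ, E) ∞ M] : Prop :=
  ContMDiff 𝓘(ℝ, E) 𝓘(ℝ, E).tangent ∞ (fun x => (⟨x, X x⟩ : TangentBundle 𝓘(ℝ, E) M))

/-- A complex structure on `M`: a smooth field `J` of endomorphisms with `J² = -Id`, integrable in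
the sense that `[JX, JY] = [X, Y] + J[JX, Y] + J[X, JY]` for all smooth vector fields. -/
structure IsComplexStructure [IsManifold 𝓘(ℝ, E) ∞ M] (J : EndField E M) : Prop where
  smooth : ContMDiff 𝓘(ℝ, E) (𝓘(ℝ, E).prod 𝓘(ℝ, E →L[ℝ] E)) ∞
    (fun x : M => Bundle.TotalSpace.mk' (E →L[ℝ] E)
      (E := fun x : M => TangentSpace 𝓘(ℝ, E) x →L[ℝ] TangentSpace 𝓘(ℝ, E) x) x (J x))
  sq_eq : ∀ (x : M) (v : TangentSpace 𝓘(ℝ, E) x), J x (J x v) = -v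
  integrable : ∀ X Y : (x : M) → TangentSpace 𝓘(ℝ, E) x,
    IsSmoothVectorField X → IsSmoothVectorField Y → ∀ x : M,
      VectorField.mlieBracket 𝓘(ℝ, E) (fun x => J x (X x)) (fun x => J x (Y x)) x =
        VectorField.mlieBracket 𝓘(ℝ, E) X Y x
          + J x (VectorField.mlieBracket 𝓘(ℝ, E) (fun x => J x (X x)) Y x)
          + J x (VectorField.mlieBracket 𝓘(ℝ, E) X (fun x => J x (Y x)) x)

/-- A differentiable family `(M, J t)`, `t ∈ (-ε, ε)`, of complex manifolds with underlying smooth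
manifold `M`: every `J t` is a complex structure, and `J t` is smooth jointly in `t` and the point
of `M`. -/
structure IsDifferentiableFamily [IsManifold 𝓘(ℝ, E) ∞ M] (ε : ℝ) (J : ℝ → EndField E M) :
    Prop where
  isComplexStructure : ∀ t ∈ Set.Ioo (-ε) ε, IsComplexStructure (J t)
  smooth : ContMDiffOn (𝓘(ℝ, ℝ).prod 𝓘(ℝ, E)) (𝓘(ℝ, E).prod 𝓘(ℝ, E →L[ℝ] E)) ∞
    (fun p : ℝ × M => Bundle.TotalSpace.mk' (E →L[ℝ] E)
      (E := fun x : M => TangentSpace 𝓘(ℝ, E) x →L[ℝ] TangentSpace 𝓘(ℝ, E) x) p.2 (J p.1 p.2))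
    (Set.Ioo (-ε) ε ×ˢ Set.univ)

/-- `Ω^{p,q}_J(M)` (inside the forms of degree `k`; of interest only for `k = p + q`): smooth forms
of type `(p,q)` at every point. -/
def IsTypeForm (J : EndField E M) (p q : ℕ) (σ : CForm E M k) : Prop :=
  σ.IsSmooth ∧ ∀ x, IsType (J x) p q (σ x)

/-- The projection `π^{p,q}` of differential forms onto their component of type `(p,q)`. -/
def proj (J : EndField E M) (p q : ℕ) (σ : CForm E M k) : CForm E M k :=
  fun x => typePart (J x) p q (σ x)

/-- The operator `∂`: on a form of type `(p,q)` it is `π^{p+1,q} ∘ d`, extended additively. -/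
def del (J : EndField E M) (σ : CForm E M k) : CForm E M (k + 1) :=
  ∑ a ∈ Finset.HasAntidiagonal.antidiagonal k, proj J (a.1 + 1) a.2 (proj J a.1 a.2 σ).d

/-- The operator `∂̄`: on a form of type `(p,q)` it is `π^{p,q+1} ∘ d`, extended additively. -/
def delbar (J : EndField E M) (σ : CForm E M k) : CForm E M (k + 1) :=
  ∑ a ∈ Finset.HasAntidiagonal.antidiagonal k, proj J a.1 (a.2 + 1) (proj J a.1 a.2 σ).d

/-- `H^{p,q}_J(M)`, for `p + q = k`: the subspace of the classes in `H^k_dR(M; ℂ)` that have a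
closed representative of type `(p,q)` (these classes form a subspace, so that taking the span adds
nothing). -/
def typeCohomology (J : EndField E M) (k p q : ℕ) : Submodule ℂ (DeRham E M k) :=
  Submodule.span ℂ {a | ∃ α : closedForms E M k,
    IsTypeForm J p q (α : CForm E M k) ∧ a = Submodule.Quotient.mk α}

/-- `J` is complex-`C^∞`-full at the `k`-th stage: `H^k_dR(M; ℂ)` is the sum of the subspaces
`H^{p,q}_J(M)` with `p + q = k`. -/
def IsComplexCInftyFull (J : EndField E M) (k : ℕ) : Prop :=
  ⨆ a ∈ Finset.HasAntidiagonal.antidiagonal k, typeCohomology J k a.1 a.2 = ⊤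

/-- The set `Δ(X, σ)`, `X = (M, J)`: the smooth complex-valued `1`-forms `γ` such that
`dγ = σ - (α^{2,0} + α^{1,1} + α^{0,2})` for some closed forms `α^{p,q}` of type `(p,q)`. -/
def Delta (J : EndField E M) (σ : CForm E M 2) : Set (CForm E M 1) :=
  {γ | γ.IsSmooth ∧ ∃ α₂₀ α₁₁ α₀₂ : CForm E M 2,
    (IsTypeForm J 2 0 α₂₀ ∧ α₂₀.IsClosed) ∧ (IsTypeForm J 1 1 α₁₁ ∧ α₁₁.IsClosed) ∧
    (IsTypeForm J 0 2 α₀₂ ∧ α₀₂.IsClosed) ∧ γ.d = σ - (α₂₀ + α₁₁ + α₀₂)}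

/-- `σ` is a complex symplectic form on `(M, J)`: smooth, of type `(2,0)`, closed, non-degenerate.
A form of type `(2,0)` satisfies `σ(v, w) = σ_ℂ(v^{1,0}, w^{1,0})` for real tangent vectors, so
non-degeneracy on `T^{1,0}M` is what the last field says. -/
structure IsComplexSymplecticForm (J : EndField E M) (σ : CForm E M 2) : Prop where
  isTypeForm : IsTypeForm J 2 0 σ
  closed : σ.IsClosed
  nondegenerate : ∀ (x : M) (v : TangentSpace 𝓘(ℝ, E) x),
    (∀ w : TangentSpace 𝓘(ℝ, E) x, σ x ![v, w] = 0) → v = 0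

/-- The manifold `(M, J)` is complex symplectic: it carries a complex symplectic form. -/
def IsComplexSymplectic (J : EndField E M) : Prop :=
  ∃ σ : CForm E M 2, IsComplexSymplecticForm J σ

end Complex

end CplxSympl

end

noncomputable section

namespace CplxSympl

/-! Two properties of the `(2,0)`-part of the form have to be checked: closedness for every `t ≠ 0`,
and non-degeneracy for small `t`.

Closedness is a bidegree count. Fix `t ≠ 0`, let `γ` be the given element of `Delta`, and put `η =
π^{1,0}γ`. Integrability says that `d` of a `(0,1)`-form has no `(2,0)`-part, so taking
`(2,0)`-parts in `σ = dγ + α₂₀ + α₁₁ + α₀₂` gives `π^{2,0}σ = ∂η + α₂₀`. As `α₂₀` is closed, it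
remains to see that `d∂η = 0`. Integrability also gives `dη = ∂η + ∂̄η`, and `d² = 0` then makes `F
= d∂̄η = -d∂η` a single 3-form seen in two ways. As `d` of a `(1,1)`-form it has no `(3,0)`-part; as
minus `d` of a `(2,0)`-form it has no `(1,2)`- or `(0,3)`-part; its `(2,1)`-part is `∂∂̄η`, which
vanishes by hypothesis. Hence `F = 0`. This is `isClosed_of_d_add_d_eq_zero` and
`isClosed_proj_two_zero`, with the linear algebra in `three_form_eq_zero`.

The bidegree facts about `d` are proved in coordinates (`typePart_zero_two_extDeriv`,
`typePart_two_zero_extDeriv`, `extDeriv_two_zero`, `extDeriv_one_one`): the type of a form is an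
identity involving `J`, its derivative brings in derivatives of `J`, and these combine into the
Nijenhuis tensor, which vanishes by `IsComplexStructure.nijenhuisVanishes`.

Non-degeneracy is an open condition. It holds at `t = 0`, where `π^{2,0}σ = σ`, the `(2,0)`-part is
continuous in `(t, x)`, and compactness of `M` makes the range of `t` uniform
(`eventually_isNondegenerate_proj`). -/

theorem vec_one_eq {V : Type*} (v : Fin 1 → V) : v = ![v 0] := by
  ext i; fin_cases i; rfl
theorem vec_two_eq {V : Type*} (v : Fin 2 → V) : v = ![v 0, v 1] := by
  ext i; fin_cases i <;> rfl
theorem vec_three_eq {V : Type*} (v : Fin 3 → V) : v = ![v 0, v 1, v 2] := by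
  ext i; fin_cases i <;> rfl

/-! ### Pointwise type decomposition in degrees one, two and three -/

section LinearAlgebra

variable {V : Type*} [AddCommGroup V] [Module ℝ V] [TopologicalSpace V] {k : ℕ}

/-- The sign `∓i` attached to a slot that takes a vector of type `(1,0)` or `(0,1)`. -/
def slotSign (A : Finset (Fin k)) (i : Fin k) : ℂ := if i ∈ A then -Complex.I else Complex.I

theorem slotPart_apply (J : V →L[ℝ] V) (A : Finset (Fin k)) (σ : V [⋀^Fin k]→L[ℝ] ℂ)
    (v : Fin k → V) : slotPart J A σ v = ∑ S : Finset (Fin k),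
      (∏ i : Fin k, (1 / 2 : ℂ) * (if i ∈ S then slotSign A i else 1)) *
        σ (fun i => if i ∈ S then J (v i) else v i) := by
  simp only [slotPart, sum_apply, smul_apply, smul_eq_mul]
  refine Finset.sum_congr rfl fun S _ => ?_
  refine congrArg₂ (· * ·) rfl ?_
  refine congrArg σ (funext fun i => ?_)
  dsimp only
  split_ifs <;> rfl

theorem sum_finset_fin_one {α : Type*} [AddCommMonoid α] (f : Finset (Fin 1) → α) :
    ∑ S, f S = f ∅ + f {0} := by
  have h : (Finset.univ : Finset (Finset (Fin 1))) = {∅, {0}} := by decide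
  rw [h, Finset.sum_insert (by decide), Finset.sum_singleton]

theorem sum_finset_fin_two {α : Type*} [AddCommMonoid α] (f : Finset (Fin 2) → α) :
    ∑ S, f S = f ∅ + (f {0} + (f {1} + f {0, 1})) := by
  have h : (Finset.univ : Finset (Finset (Fin 2))) = {∅, {0}, {1}, {0, 1}} := by decide
  rw [h, Finset.sum_insert (by decide), Finset.sum_insert (by decide),
    Finset.sum_insert (by decide), Finset.sum_singleton]

theorem sum_finset_fin_three {α : Type*} [AddCommMonoid α] (f : Finset (Fin 3) → α) :
    ∑ S, f S = f ∅ + (f {0} + (f {1} + (f {2} + (f {0, 1} + (f {0, 2} +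
      (f {1, 2} + f {0, 1, 2})))))) := by
  have h : (Finset.univ : Finset (Finset (Fin 3))) =
    {∅, {0}, {1}, {2}, {0, 1}, {0, 2}, {1, 2}, {0, 1, 2}} := by decide
  rw [h, Finset.sum_insert (by decide), Finset.sum_insert (by decide),
    Finset.sum_insert (by decide), Finset.sum_insert (by decide), Finset.sum_insert (by decide),
    Finset.sum_insert (by decide), Finset.sum_insert (by decide), Finset.sum_singleton]

theorem slotPart_one (J : V →L[ℝ] V) (A : Finset (Fin 1)) (σ : V [⋀^Fin 1]→L[ℝ] ℂ) (v : V) :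
    slotPart J A σ ![v] = 1 / 2 * (σ ![v] + slotSign A 0 * σ ![J v]) := by
  rw [slotPart_apply, sum_finset_fin_one]
  have e1 : (fun i : Fin 1 => if i ∈ (∅ : Finset (Fin 1)) then J (![v] i) else ![v] i) = ![v] := by
    ext i; fin_cases i; simp
  have e2 : (fun i : Fin 1 => if i ∈ ({0} : Finset (Fin 1)) then J (![v] i) else ![v] i) =
      ![J v] := by
    ext i; fin_cases i; simp
  rw [e1, e2]
  simp
  ring

theorem slotPart_two (J : V →L[ℝ] V) (A : Finset (Fin 2)) (σ : V [⋀^Fin 2]→L[ℝ] ℂ) (v w : V) :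
    slotPart J A σ ![v, w] = 1 / 4 * (σ ![v, w] + slotSign A 0 * σ ![J v, w]
      + slotSign A 1 * σ ![v, J w] + slotSign A 0 * slotSign A 1 * σ ![J v, J w]) := by
  rw [slotPart_apply, sum_finset_fin_two]
  have e (S : Finset (Fin 2)) : (fun i : Fin 2 => if i ∈ S then J (![v, w] i) else ![v, w] i) =
      ![if 0 ∈ S then J v else v, if 1 ∈ S then J w else w] := by
    ext i; fin_cases i <;> simp
  simp only [e]
  simp [Fin.prod_univ_two]
  ring

theorem slotPart_three (J : V →L[ℝ] V) (A : Finset (Fin 3)) (σ : V [⋀^Fin 3]→L[ℝ] ℂ) (u v w : V) :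
    slotPart J A σ ![u, v, w] = 1 / 8 * (σ ![u, v, w] + slotSign A 0 * σ ![J u, v, w]
      + slotSign A 1 * σ ![u, J v, w] + slotSign A 2 * σ ![u, v, J w]
      + slotSign A 0 * slotSign A 1 * σ ![J u, J v, w]
      + slotSign A 0 * slotSign A 2 * σ ![J u, v, J w]
      + slotSign A 1 * slotSign A 2 * σ ![u, J v, J w]
      + slotSign A 0 * slotSign A 1 * slotSign A 2 * σ ![J u, J v, J w]) := by
  rw [slotPart_apply, sum_finset_fin_three]
  have e (S : Finset (Fin 3)) : (fun i : Fin 3 => if i ∈ S then J (![u, v, w] i)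
      else ![u, v, w] i) = ![if 0 ∈ S then J u else u, if 1 ∈ S then J v else v,
        if 2 ∈ S then J w else w] := by
    ext i; fin_cases i <;> simp
  simp only [e]
  simp [Fin.prod_univ_three]
  ring

theorem typePart_apply (J : V →L[ℝ] V) (p q : ℕ) (σ : V [⋀^Fin k]→L[ℝ] ℂ) (v : Fin k → V) :
    typePart J p q σ v = ∑ A : Finset (Fin k), (if A.card = p ∧ Aᶜ.card = q then (1 : ℂ) else 0) *
      slotPart J A σ v := by
  show typePartAux J p q σ v = _
  simp only [typePartAux, sum_apply, smul_apply, smul_eq_mul]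

theorem typePart_one_zero (J : V →L[ℝ] V) (σ : V [⋀^Fin 1]→L[ℝ] ℂ) (v : V) :
    typePart J 1 0 σ ![v] = 1 / 2 * (σ ![v] - Complex.I * σ ![J v]) := by
  simp [typePart_apply, sum_finset_fin_one, slotPart_one, slotSign, Finset.card_compl]
  ring

theorem typePart_zero_one (J : V →L[ℝ] V) (σ : V [⋀^Fin 1]→L[ℝ] ℂ) (v : V) :
    typePart J 0 1 σ ![v] = 1 / 2 * (σ ![v] + Complex.I * σ ![J v]) := by
  simp [typePart_apply, sum_finset_fin_one, slotPart_one, slotSign, Finset.card_compl]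

theorem typePart_two_zero (J : V →L[ℝ] V) (σ : V [⋀^Fin 2]→L[ℝ] ℂ) (v w : V) :
    typePart J 2 0 σ ![v, w] = 1 / 4 * (σ ![v, w] - Complex.I * σ ![J v, w]
      - Complex.I * σ ![v, J w] - σ ![J v, J w]) := by
  simp [typePart_apply, sum_finset_fin_two, slotPart_two, slotSign, Finset.card_compl]
  ring

theorem typePart_zero_two (J : V →L[ℝ] V) (σ : V [⋀^Fin 2]→L[ℝ] ℂ) (v w : V) :
    typePart J 0 2 σ ![v, w] = 1 / 4 * (σ ![v, w] + Complex.I * σ ![J v, w]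
      + Complex.I * σ ![v, J w] - σ ![J v, J w]) := by
  simp [typePart_apply, sum_finset_fin_two, slotPart_two, slotSign, Finset.card_compl]
  ring

theorem typePart_one_one (J : V →L[ℝ] V) (σ : V [⋀^Fin 2]→L[ℝ] ℂ) (v w : V) :
    typePart J 1 1 σ ![v, w] = 1 / 2 * (σ ![v, w] + σ ![J v, J w]) := by
  simp [typePart_apply, sum_finset_fin_two, slotPart_two, slotSign, Finset.card_compl]
  ring

theorem typePart_add (J : V →L[ℝ] V) (p q : ℕ) (σ τ : V [⋀^Fin k]→L[ℝ] ℂ) :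
    typePart J p q (σ + τ) = typePart J p q σ + typePart J p q τ := by
  ext v
  simp only [typePart_apply, slotPart_apply, ContinuousAlternatingMap.add_apply, mul_add,
    Finset.sum_add_distrib]

theorem typePart_sum_two (J : V →L[ℝ] V) (σ : V [⋀^Fin 2]→L[ℝ] ℂ) :
    typePart J 2 0 σ + typePart J 1 1 σ + typePart J 0 2 σ = σ := by
  ext v
  rw [vec_two_eq v]
  simp only [ContinuousAlternatingMap.add_apply, typePart_two_zero, typePart_one_one,
    typePart_zero_two]
  ring

theorem typePart_sum_one (J : V →L[ℝ] V) (σ : V [⋀^Fin 1]→L[ℝ] ℂ) :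
    typePart J 1 0 σ + typePart J 0 1 σ = σ := by
  ext v
  rw [vec_one_eq v]
  simp only [ContinuousAlternatingMap.add_apply, typePart_one_zero, typePart_zero_one]
  ring

end LinearAlgebra

theorem update_vec_one {V : Type*} (v w : V) : Function.update ![v] 0 w = ![w] := by
  ext i; fin_cases i; rfl

theorem update_vec_two_zero {V : Type*} (u v w : V) : Function.update ![u, v] 0 w = ![w, v] := by
  ext i; fin_cases i <;> rfl

theorem update_vec_two_one {V : Type*} (u v w : V) : Function.update ![u, v] 1 w = ![u, w] := by
  ext i; fin_cases i <;> rfl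

section LinearAlgebra

variable {V : Type*} [AddCommGroup V] [Module ℝ V] [TopologicalSpace V] {k : ℕ}

theorem map_neg_fin_one (σ : V [⋀^Fin 1]→L[ℝ] ℂ) (v : V) : σ ![-v] = -σ ![v] := by
  have h := σ.map_update_smul ![v] 0 (-1) v
  simpa [update_vec_one, update_vec_two_zero, update_vec_two_one] using h

theorem map_neg_left (σ : V [⋀^Fin 2]→L[ℝ] ℂ) (v w : V) : σ ![-v, w] = -σ ![v, w] := by
  have h := σ.map_update_smul ![v, w] 0 (-1) v
  simpa [update_vec_one, update_vec_two_zero, update_vec_two_one] using h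

theorem map_neg_right (σ : V [⋀^Fin 2]→L[ℝ] ℂ) (v w : V) : σ ![v, -w] = -σ ![v, w] := by
  have h := σ.map_update_smul ![v, w] 1 (-1) w
  simpa [update_vec_one, update_vec_two_zero, update_vec_two_one] using h

theorem typePart_eq_zero_of_isType {J : V →L[ℝ] V} {p q p' q' : ℕ} {σ : V [⋀^Fin k]→L[ℝ] ℂ}
    (h : IsType J p q σ) (hpq : ¬ (p' = p ∧ q' = q)) : typePart J p' q' σ = 0 := by
  ext v
  rw [typePart_apply]
  refine Finset.sum_eq_zero fun A _ => ?_
  split_ifs with hA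
  · rw [h A (by rw [hA.1, hA.2]; exact hpq)]
    simp
  · simp

theorem typePart_two_zero_of_isType {J : V →L[ℝ] V} {σ : V [⋀^Fin 2]→L[ℝ] ℂ}
    (h : IsType J 2 0 σ) : typePart J 2 0 σ = σ := by
  have h1 := typePart_sum_two J σ
  rwa [typePart_eq_zero_of_isType (p' := 1) (q' := 1) h (by simp),
    typePart_eq_zero_of_isType (p' := 0) (q' := 2) h (by simp), add_zero, add_zero] at h1

variable {J : V →L[ℝ] V} (hJ : ∀ v, J (J v) = -v)
include hJ

theorem typePart_two_zero_map_left (σ : V [⋀^Fin 2]→L[ℝ] ℂ) (v w : V) :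
    typePart J 2 0 σ ![J v, w] = Complex.I * typePart J 2 0 σ ![v, w] := by
  simp only [typePart_two_zero, hJ, map_neg_left]
  linear_combination (σ ![J v, w] + σ ![v, J w]) / 4 * Complex.I_sq

theorem typePart_two_zero_map_right (σ : V [⋀^Fin 2]→L[ℝ] ℂ) (v w : V) :
    typePart J 2 0 σ ![v, J w] = Complex.I * typePart J 2 0 σ ![v, w] := by
  simp only [typePart_two_zero, hJ, map_neg_right]
  linear_combination (σ ![J v, w] + σ ![v, J w]) / 4 * Complex.I_sq

theorem typePart_one_one_map (σ : V [⋀^Fin 2]→L[ℝ] ℂ) (v w : V) :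
    typePart J 1 1 σ ![J v, J w] = typePart J 1 1 σ ![v, w] := by
  simp only [typePart_one_one, hJ, map_neg_right, map_neg_left]
  ring

theorem typePart_one_one_map_swap (σ : V [⋀^Fin 2]→L[ℝ] ℂ) (v w : V) :
    typePart J 1 1 σ ![v, J w] = -typePart J 1 1 σ ![J v, w] := by
  simp only [typePart_one_one, hJ, map_neg_right, map_neg_left]
  ring

theorem typePart_one_zero_map (σ : V [⋀^Fin 1]→L[ℝ] ℂ) (v : V) :
    typePart J 1 0 σ ![J v] = Complex.I * typePart J 1 0 σ ![v] := by
  simp only [typePart_one_zero, hJ, map_neg_fin_one]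
  linear_combination σ ![J v] / 2 * Complex.I_sq

theorem typePart_zero_one_map (σ : V [⋀^Fin 1]→L[ℝ] ℂ) (v : V) :
    typePart J 0 1 σ ![J v] = -Complex.I * typePart J 0 1 σ ![v] := by
  simp only [typePart_zero_one, hJ, map_neg_fin_one]
  linear_combination σ ![J v] / 2 * Complex.I_sq

/-- In either slot `J` acts on the `(2,0)`-part as multiplication by `i`, so a slot filled with a
vector of type `(0,1)` contributes the factor `1 + i·i = 0`. -/
theorem isType_typePart_two_zero (σ : V [⋀^Fin 2]→L[ℝ] ℂ) : IsType J 2 0 (typePart J 2 0 σ) := by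
  intro A hA
  have hA' : ¬ (0 ∈ A ∧ 1 ∈ A) := by
    rintro ⟨h0, h1⟩
    have : A = Finset.univ := by ext i; fin_cases i <;> simp [h0, h1]
    exact hA (by simp [this])
  ext v
  rw [vec_two_eq v, slotPart_two]
  simp only [typePart_two_zero_map_left hJ, typePart_two_zero_map_right hJ]
  simp only [slotSign]
  rw [not_and_or] at hA'
  rcases hA' with h | h
  · simp only [h, if_false]
    show _ = (0 : ℂ)
    linear_combination (1 / 4 * typePart J 2 0 σ ![v 0, v 1] *
      (1 + (if 1 ∈ A then -Complex.I else Complex.I) * Complex.I)) * Complex.I_sq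
  · simp only [h, if_false]
    show _ = (0 : ℂ)
    linear_combination (1 / 4 * typePart J 2 0 σ ![v 0, v 1] *
      (1 + (if 0 ∈ A then -Complex.I else Complex.I) * Complex.I)) * Complex.I_sq

theorem typePart_one_zero_idem (σ : V [⋀^Fin 1]→L[ℝ] ℂ) :
    typePart J 1 0 (typePart J 1 0 σ) = typePart J 1 0 σ := by
  ext v
  rw [vec_one_eq v, typePart_one_zero _ (typePart _ _ _ _), typePart_one_zero_map hJ]
  linear_combination -1 / 2 * typePart J 1 0 σ ![v 0] * Complex.I_sq

theorem typePart_zero_one_one_zero (σ : V [⋀^Fin 1]→L[ℝ] ℂ) :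
    typePart J 0 1 (typePart J 1 0 σ) = 0 := by
  ext v
  rw [vec_one_eq v, typePart_zero_one _ (typePart _ _ _ _), typePart_one_zero_map hJ]
  show _ = (0 : ℂ)
  linear_combination 1 / 2 * typePart J 1 0 σ ![v 0] * Complex.I_sq

theorem typePart_one_one_idem (σ : V [⋀^Fin 2]→L[ℝ] ℂ) :
    typePart J 1 1 (typePart J 1 1 σ) = typePart J 1 1 σ := by
  ext v
  rw [vec_two_eq v, typePart_one_one _ (typePart _ _ _ _), typePart_one_one_map hJ]
  ring

theorem typePart_two_zero_one_one (σ : V [⋀^Fin 2]→L[ℝ] ℂ) :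
    typePart J 2 0 (typePart J 1 1 σ) = 0 := by
  ext v
  rw [vec_two_eq v, typePart_two_zero _ (typePart _ _ _ _), typePart_one_one_map hJ,
    typePart_one_one_map_swap hJ]
  show _ = (0 : ℂ)
  ring

theorem typePart_zero_two_one_one (σ : V [⋀^Fin 2]→L[ℝ] ℂ) :
    typePart J 0 2 (typePart J 1 1 σ) = 0 := by
  ext v
  rw [vec_two_eq v, typePart_zero_two _ (typePart _ _ _ _), typePart_one_one_map hJ,
    typePart_one_one_map_swap hJ]
  show _ = (0 : ℂ)
  ring

omit hJ

/-- A `3`-form vanishes when its parts of type `(3,0)` and `(2,1)` do and when contractions with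
two vectors of type `(0,1)` are zero. -/
theorem three_form_eq_zero (F : V [⋀^Fin 3]→L[ℝ] ℂ)
    (h30 : ∀ u v w, F ![u, v, w] - Complex.I * F ![J u, v, w] - Complex.I * F ![u, J v, w]
      - Complex.I * F ![u, v, J w] - F ![J u, J v, w] - F ![J u, v, J w] - F ![u, J v, J w]
      + Complex.I * F ![J u, J v, J w] = 0)
    (h21 : typePart J 2 1 F = 0)
    (h02 : ∀ u v w, F ![u, v, w] + Complex.I * F ![u, J v, w] + Complex.I * F ![u, v, J w]
      - F ![u, J v, J w] = 0) : F = 0 := by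
  ext v
  rw [vec_three_eq v]
  set a := v 0
  set b := v 1
  set c := v 2
  have h21' : typePart J 2 1 F ![a, b, c] = 0 := by rw [h21]; rfl
  simp [typePart_apply, sum_finset_fin_three, slotPart_three, slotSign, Finset.card_compl] at h21'
  have sw (x y z : V) : F ![y, x, z] = -F ![x, y, z] := by
    have h := F.toAlternatingMap.map_swap ![x, y, z] (i := 0) (j := 1) (by decide)
    have e : ![x, y, z] ∘ Equiv.swap (0 : Fin 3) 1 = ![y, x, z] := by
      ext i; fin_cases i <;> rfl
    rw [e] at h
    exact h
  have sw' (x y z : V) : F ![x, z, y] = -F ![x, y, z] := by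
    have h := F.toAlternatingMap.map_swap ![x, y, z] (i := 1) (j := 2) (by decide)
    have e : ![x, y, z] ∘ Equiv.swap (1 : Fin 3) 2 = ![x, z, y] := by
      ext i; fin_cases i <;> rfl
    rw [e] at h
    exact h
  have rot (x y z : V) : F ![x, y, z] = F ![y, z, x] := by
    rw [sw' y x z, sw x y z, neg_neg]
  -- Split `F(a,b,c)` into its eight slot parts. The `(3,0)`- and `(2,1)`-parts are `h3 / 8` and
  -- `h21'`; left are the parts with at least two `(0,1)`-slots. `f1 / 4` and `g1 / 4` give those
  -- with `(0,1)` in the slots of `a`, `c` and of `a`, `b`, counting the `(0,3)`-part twice. Since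
  -- `a^{1,0} - a^{0,1} = -iJa`, the term in `e2` adds the missing part with `a` of type `(1,0)` and
  -- removes the double count.
  have e2 := h02 (J a) b c
  have f1 := h02 b c a
  rw [← rot a b c, ← rot a b (J c), ← rot (J a) b c, ← rot (J a) b (J c)] at f1
  have g1 := h02 c a b
  rw [rot c a b, rot c (J a) b, rot c a (J b), rot c (J a) (J b)] at g1
  have h3 := h30 a b c
  show _ = (0 : ℂ)
  linear_combination (norm := skip) f1 / 4 + g1 / 4 - Complex.I * e2 / 4 + h21' + h3 / 8
  ring_nf
  simp only [Complex.I_sq]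
  ring_nf

end LinearAlgebra

/-! ### Exterior derivatives and the product rule in low degree -/

section Derivative

variable {E : Type*} [NormedAddCommGroup E] [NormedSpace ℝ E]

theorem extDeriv_fin_one (s : E → E [⋀^Fin 1]→L[ℝ] ℂ) (y u v : E) :
    extDeriv s y ![u, v] = fderiv ℝ s y u ![v] - fderiv ℝ s y v ![u] := by
  simp only [extDeriv, ContinuousAlternatingMap.alternatizeUncurryFin_apply]
  refine (Fin.sum_univ_two _).trans ?_
  have e0 : Fin.removeNth 0 ![u, v] = ![v] := by ext i; fin_cases i; rfl
  have e1 : Fin.removeNth 1 ![u, v] = ![u] := by ext i; fin_cases i; rfl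
  rw [e0, e1]
  simp
  ring

theorem extDeriv_fin_two (s : E → E [⋀^Fin 2]→L[ℝ] ℂ) (y u v w : E) :
    extDeriv s y ![u, v, w] = fderiv ℝ s y u ![v, w] - fderiv ℝ s y v ![u, w]
      + fderiv ℝ s y w ![u, v] := by
  simp only [extDeriv, ContinuousAlternatingMap.alternatizeUncurryFin_apply]
  refine (Fin.sum_univ_three _).trans ?_
  have e0 : Fin.removeNth 0 ![u, v, w] = ![v, w] := by ext i; fin_cases i <;> rfl
  have e1 : Fin.removeNth 1 ![u, v, w] = ![u, w] := by ext i; fin_cases i <;> rfl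
  have e2 : Fin.removeNth 2 ![u, v, w] = ![u, v] := by ext i; fin_cases i <;> rfl
  rw [e0, e1, e2]
  simp
  ring

theorem hasFDerivAt_apply_fin_one {s : E → E [⋀^Fin 1]→L[ℝ] ℂ} {y : E}
    (hs : DifferentiableAt ℝ s y) {g : E → E} {g' : E →L[ℝ] E} (hg : HasFDerivAt g g' y) :
    ∃ L : E →L[ℝ] ℂ, HasFDerivAt (fun z => s z ![g z]) L y ∧
      ∀ u, L u = fderiv ℝ s y u ![g y] + s y ![g' u] := by
  have h := hs.hasFDerivAt.continuousAlternatingMap_apply (g := ![g]) (g' := ![g'])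
    (by intro i; fin_cases i; exact hg)
  have e (z : E) : (fun i => (![g] : Fin 1 → E → E) i z) = ![g z] := by
    ext i; fin_cases i; rfl
  simp only [e] at h
  refine ⟨_, h, fun u => ?_⟩
  simp [update_vec_one]

theorem hasFDerivAt_apply_fin_two {s : E → E [⋀^Fin 2]→L[ℝ] ℂ} {y : E}
    (hs : DifferentiableAt ℝ s y) {g h : E → E} {g' h' : E →L[ℝ] E} (hg : HasFDerivAt g g' y)
    (hh : HasFDerivAt h h' y) :
    ∃ L : E →L[ℝ] ℂ, HasFDerivAt (fun z => s z ![g z, h z]) L y ∧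
      ∀ u, L u = fderiv ℝ s y u ![g y, h y] + s y ![g' u, h y] + s y ![g y, h' u] := by
  have H := hs.hasFDerivAt.continuousAlternatingMap_apply (g := ![g, h]) (g' := ![g', h'])
    (by intro i; fin_cases i; exacts [hg, hh])
  have e (z : E) : (fun i => (![g, h] : Fin 2 → E → E) i z) = ![g z, h z] := by
    ext i; fin_cases i <;> rfl
  simp only [e] at H
  refine ⟨_, H, fun u => ?_⟩
  simp [Fin.sum_univ_two, update_vec_two_zero, update_vec_two_one, add_assoc]

end Derivative

section MapSub

variable {V : Type*} [AddCommGroup V] [Module ℝ V] [TopologicalSpace V]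

theorem map_add_fin_one (σ : V [⋀^Fin 1]→L[ℝ] ℂ) (v w : V) :
    σ ![v + w] = σ ![v] + σ ![w] := by
  have h := σ.map_update_add ![v] 0 v w
  simpa only [update_vec_one] using h

theorem map_add_left (σ : V [⋀^Fin 2]→L[ℝ] ℂ) (v w u : V) :
    σ ![v + w, u] = σ ![v, u] + σ ![w, u] := by
  have h := σ.map_update_add ![v, u] 0 v w
  simpa only [update_vec_two_zero] using h

theorem map_sub_fin_one (σ : V [⋀^Fin 1]→L[ℝ] ℂ) (v w : V) :
    σ ![v - w] = σ ![v] - σ ![w] := by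
  rw [sub_eq_add_neg, map_add_fin_one, map_neg_fin_one, sub_eq_add_neg]

theorem map_sub_left (σ : V [⋀^Fin 2]→L[ℝ] ℂ) (v w u : V) :
    σ ![v - w, u] = σ ![v, u] - σ ![w, u] := by
  rw [sub_eq_add_neg, map_add_left, map_neg_left, sub_eq_add_neg]

theorem map_zero_fin_one (σ : V [⋀^Fin 1]→L[ℝ] ℂ) : σ ![0] = 0 :=
  σ.map_coord_zero 0 rfl

theorem map_zero_left (σ : V [⋀^Fin 2]→L[ℝ] ℂ) (u : V) : σ ![0, u] = 0 :=
  σ.map_coord_zero 0 rfl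

theorem map_swap_fin_two (σ : V [⋀^Fin 2]→L[ℝ] ℂ) (u v : V) : σ ![u, v] = -σ ![v, u] := by
  have h := σ.toAlternatingMap.map_swap ![v, u] (i := 0) (j := 1) (by decide)
  have e : ![v, u] ∘ Equiv.swap (0 : Fin 2) 1 = ![u, v] := by
    ext i; fin_cases i <;> rfl
  rw [e] at h
  exact h

end MapSub

/-! ### Integrability and the types of exterior derivatives, in coordinates -/

section Integrability

variable {E : Type*} [NormedAddCommGroup E] [NormedSpace ℝ E]

/-- The Nijenhuis tensor of the field `J` of endomorphisms vanishes at `y`. -/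
def NijenhuisVanishes (J : E → E →L[ℝ] E) (y : E) : Prop :=
  ∀ v w : E, fderiv ℝ J y (J y v) w - fderiv ℝ J y (J y w) v + J y (fderiv ℝ J y w v)
    - J y (fderiv ℝ J y v w) = 0

variable {J : E → E →L[ℝ] E} {y : E}

theorem hasFDerivAt_clm_apply_const (hJ : DifferentiableAt ℝ J y) (v : E) :
    HasFDerivAt (fun z => J z v) ((fderiv ℝ J y).flip v) y := by
  have h := hJ.hasFDerivAt.clm_apply (hasFDerivAt_const v y)
  simpa using h

/-- Being of a given type is an identity involving `J`; differentiating it along `u` trades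
derivatives of `s` for a term with the derivative of `J`. The next four lemmas do the same in degree
two. -/
theorem fderiv_one_form_map (hJ : DifferentiableAt ℝ J y) {s : E → E [⋀^Fin 1]→L[ℝ] ℂ}
    (hs : DifferentiableAt ℝ s y) {c : ℂ}
    (hc : ∀ᶠ z in 𝓝 y, ∀ v, s z ![J z v] = c * s z ![v]) (u v : E) :
    fderiv ℝ s y u ![J y v] + s y ![fderiv ℝ J y u v] = c * fderiv ℝ s y u ![v] := by
  obtain ⟨L, hL, hL'⟩ := hasFDerivAt_apply_fin_one hs (hasFDerivAt_clm_apply_const hJ v)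
  have h2 := (hs.hasFDerivAt.continuousAlternatingMap_apply_const ![v]).const_mul c
  have h3 := hL.congr_of_eventuallyEq (f₁ := fun z => c * s z ![v])
    (hc.mono fun z hz => (hz v).symm)
  have h4 := congrArg (fun T : E →L[ℝ] ℂ => T u) (h3.unique h2)
  simp only [hL'] at h4
  simpa using h4

theorem fderiv_two_form_map_left (hJ : DifferentiableAt ℝ J y) {s : E → E [⋀^Fin 2]→L[ℝ] ℂ}
    (hs : DifferentiableAt ℝ s y) {c : ℂ}
    (hc : ∀ᶠ z in 𝓝 y, ∀ v w, s z ![J z v, w] = c * s z ![v, w]) (u v w : E) :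
    fderiv ℝ s y u ![J y v, w] + s y ![fderiv ℝ J y u v, w] = c * fderiv ℝ s y u ![v, w] := by
  obtain ⟨L, hL, hL'⟩ := hasFDerivAt_apply_fin_two hs (hasFDerivAt_clm_apply_const hJ v)
    (hasFDerivAt_const w y)
  have h2 := (hs.hasFDerivAt.continuousAlternatingMap_apply_const ![v, w]).const_mul c
  have h3 := hL.congr_of_eventuallyEq (f₁ := fun z => c * s z ![v, w])
    (hc.mono fun z hz => (hz v w).symm)
  have h4 := congrArg (fun T : E →L[ℝ] ℂ => T u) (h3.unique h2)
  simp only [hL', zero_apply] at h4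
  rw [(s y).map_coord_zero (m := ![J y v, 0]) 1 rfl, add_zero] at h4
  simpa using h4

theorem fderiv_two_form_map_right (hJ : DifferentiableAt ℝ J y) {s : E → E [⋀^Fin 2]→L[ℝ] ℂ}
    (hs : DifferentiableAt ℝ s y) {c : ℂ}
    (hc : ∀ᶠ z in 𝓝 y, ∀ v w, s z ![J z v, w] = c * s z ![v, w]) (u v w : E) :
    fderiv ℝ s y u ![v, J y w] + s y ![v, fderiv ℝ J y u w] = c * fderiv ℝ s y u ![v, w] := by
  have h := fderiv_two_form_map_left hJ hs hc u w v
  rw [map_swap_fin_two _ v (J y w), map_swap_fin_two _ v w, map_swap_fin_two _ v]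
  linear_combination -h

theorem fderiv_two_form_map_both (hJ : DifferentiableAt ℝ J y) {s : E → E [⋀^Fin 2]→L[ℝ] ℂ}
    (hs : DifferentiableAt ℝ s y)
    (hc : ∀ᶠ z in 𝓝 y, ∀ v w, s z ![J z v, J z w] = s z ![v, w]) (u v w : E) :
    fderiv ℝ s y u ![J y v, J y w] + s y ![fderiv ℝ J y u v, J y w]
      + s y ![J y v, fderiv ℝ J y u w] = fderiv ℝ s y u ![v, w] := by
  obtain ⟨L, hL, hL'⟩ := hasFDerivAt_apply_fin_two hs (hasFDerivAt_clm_apply_const hJ v)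
    (hasFDerivAt_clm_apply_const hJ w)
  have h2 := hs.hasFDerivAt.continuousAlternatingMap_apply_const ![v, w]
  have h3 := hL.congr_of_eventuallyEq (f₁ := fun z => s z ![v, w])
    (hc.mono fun z hz => (hz v w).symm)
  have h4 := congrArg (fun T : E →L[ℝ] ℂ => T u) (h3.unique h2)
  simp only [hL'] at h4
  simpa using h4

theorem fderiv_two_form_map_swap (hJ : DifferentiableAt ℝ J y) {s : E → E [⋀^Fin 2]→L[ℝ] ℂ}
    (hs : DifferentiableAt ℝ s y)
    (hc : ∀ᶠ z in 𝓝 y, ∀ v w, s z ![v, J z w] = -s z ![J z v, w]) (u v w : E) :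
    fderiv ℝ s y u ![v, J y w] + s y ![v, fderiv ℝ J y u w] =
      -(fderiv ℝ s y u ![J y v, w] + s y ![fderiv ℝ J y u v, w]) := by
  obtain ⟨L, hL, hL'⟩ := hasFDerivAt_apply_fin_two hs (hasFDerivAt_const v y)
    (hasFDerivAt_clm_apply_const hJ w)
  obtain ⟨L₂, hL₂, hL₂'⟩ := hasFDerivAt_apply_fin_two hs (hasFDerivAt_clm_apply_const hJ v)
    (hasFDerivAt_const w y)
  have h3 := hL.congr_of_eventuallyEq (f₁ := fun z => -s z ![J z v, w])
    (hc.mono fun z hz => (hz v w).symm)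
  have h4 := congrArg (fun T : E →L[ℝ] ℂ => T u) (h3.unique hL₂.neg)
  simp only [hL', neg_apply, hL₂', zero_apply] at h4
  rw [(s y).map_coord_zero (m := ![J y v, 0]) 1 rfl, add_zero, map_zero_left, add_zero] at h4
  simpa using h4

/-- Once the differentiated type identity has cancelled all derivatives of `s`, the remaining
derivatives of `J` assemble into `s` evaluated on the Nijenhuis tensor. -/
theorem typePart_zero_two_extDeriv (hJ : DifferentiableAt ℝ J y) (hN : NijenhuisVanishes J y)
    {s : E → E [⋀^Fin 1]→L[ℝ] ℂ} (hs : DifferentiableAt ℝ s y)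
    (hc : ∀ᶠ z in 𝓝 y, ∀ v, s z ![J z v] = Complex.I * s z ![v]) :
    typePart (J y) 0 2 (extDeriv s y) = 0 := by
  ext x
  rw [vec_two_eq x, typePart_zero_two]
  generalize x 0 = v
  generalize x 1 = w
  show _ = (0 : ℂ)
  have hD := fderiv_one_form_map hJ hs hc
  have hN' := congrArg (fun x => s y ![x]) (hN v w)
  simp only [map_sub_fin_one, map_add_fin_one, hc.self_of_nhds, map_zero_fin_one] at hN'
  simp only [extDeriv_fin_one]
  linear_combination (norm := skip) 1 / 4 * (Complex.I * hD v w - Complex.I * hD w v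
    - hD (J y v) w + hD (J y w) v + hN')
  ring_nf
  simp only [Complex.I_sq]
  ring_nf

theorem typePart_two_zero_extDeriv (hJ : DifferentiableAt ℝ J y) (hN : NijenhuisVanishes J y)
    {s : E → E [⋀^Fin 1]→L[ℝ] ℂ} (hs : DifferentiableAt ℝ s y)
    (hc : ∀ᶠ z in 𝓝 y, ∀ v, s z ![J z v] = -Complex.I * s z ![v]) :
    typePart (J y) 2 0 (extDeriv s y) = 0 := by
  ext x
  rw [vec_two_eq x, typePart_two_zero]
  generalize x 0 = v
  generalize x 1 = w
  show _ = (0 : ℂ)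
  have hD := fderiv_one_form_map hJ hs hc
  have hN' := congrArg (fun x => s y ![x]) (hN v w)
  simp only [map_sub_fin_one, map_add_fin_one, hc.self_of_nhds, map_zero_fin_one] at hN'
  simp only [extDeriv_fin_one]
  linear_combination (norm := skip) 1 / 4 * (-Complex.I * hD v w + Complex.I * hD w v
    - hD (J y v) w + hD (J y w) v + hN')
  ring_nf
  simp only [Complex.I_sq]
  ring_nf

/-- The expression is four times the contraction of `ds` with `v^{0,1}` and `w^{0,1}`. As `u` is
arbitrary, its vanishing excludes the `(1,2)`- and the `(0,3)`-part at once. -/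
theorem extDeriv_two_zero (hJ : DifferentiableAt ℝ J y) (hN : NijenhuisVanishes J y)
    {s : E → E [⋀^Fin 2]→L[ℝ] ℂ} (hs : DifferentiableAt ℝ s y)
    (hc : ∀ᶠ z in 𝓝 y, ∀ v w, s z ![J z v, w] = Complex.I * s z ![v, w]) (u v w : E) :
    extDeriv s y ![u, v, w] + Complex.I * extDeriv s y ![u, J y v, w]
      + Complex.I * extDeriv s y ![u, v, J y w] - extDeriv s y ![u, J y v, J y w] = 0 := by
  have hL := fderiv_two_form_map_left hJ hs hc
  have hR := fderiv_two_form_map_right hJ hs hc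
  have hl := hc.self_of_nhds
  have hr (a b : E) : s y ![a, J y b] = Complex.I * s y ![a, b] := by
    rw [map_swap_fin_two, hl, map_swap_fin_two _ b a]
    ring
  have hN' := congrArg (fun x => s y ![x, u]) (hN v w)
  simp only [map_sub_left, map_add_left, hl, map_zero_left] at hN'
  simp only [map_swap_fin_two _ _ u] at hN'
  simp only [extDeriv_fin_two]
  have h0 := hr (fderiv ℝ J y u v) w
  linear_combination (norm := skip) Complex.I * hL u v w - hL u v (J y w)
    - Complex.I * hR v u w + hR (J y v) u w + Complex.I * hR w u v - hR (J y w) u v + hN' + h0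
  ring_nf
  simp only [Complex.I_sq]
  ring_nf

/-- The expression is eight times the `(3,0)`-part of `ds`. The Nijenhuis tensor enters through each
of the three pairs of arguments. With `J² = -1`, which is not assumed here, `hb` and `hc` would
imply each other. -/
theorem extDeriv_one_one (hJ : DifferentiableAt ℝ J y) (hN : NijenhuisVanishes J y)
    {s : E → E [⋀^Fin 2]→L[ℝ] ℂ} (hs : DifferentiableAt ℝ s y)
    (hb : ∀ᶠ z in 𝓝 y, ∀ v w, s z ![J z v, J z w] = s z ![v, w])
    (hc : ∀ᶠ z in 𝓝 y, ∀ v w, s z ![v, J z w] = -s z ![J z v, w]) (u v w : E) :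
    extDeriv s y ![u, v, w] - Complex.I * extDeriv s y ![J y u, v, w]
      - Complex.I * extDeriv s y ![u, J y v, w] - Complex.I * extDeriv s y ![u, v, J y w]
      - extDeriv s y ![J y u, J y v, w] - extDeriv s y ![J y u, v, J y w]
      - extDeriv s y ![u, J y v, J y w] + Complex.I * extDeriv s y ![J y u, J y v, J y w] = 0 := by
  have h1 := fderiv_two_form_map_both hJ hs hb
  have h2 := fderiv_two_form_map_swap hJ hs hc
  have hb' := hb.self_of_nhds
  have hc' (a b : E) : s y ![J y a, b] = -s y ![a, J y b] := by
    rw [hc.self_of_nhds, neg_neg]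
  have sw (a b c : E) : s y ![a, fderiv ℝ J y b c] = -s y ![fderiv ℝ J y b c, a] :=
    map_swap_fin_two _ _ _
  simp only [sw] at h1 h2
  have n1 (a b c : E) := congrArg (fun x => s y ![x, c]) (hN a b)
  have n2 (a b c : E) := congrArg (fun x => s y ![x, J y c]) (hN a b)
  simp only [map_sub_left, map_add_left, hb', map_zero_left] at n2
  simp only [map_sub_left, map_add_left, map_zero_left] at n1
  have n3 (a b c : E) := hc' (fderiv ℝ J y a b) c
  simp only [n3] at n1
  simp only [extDeriv_fin_two]
  linear_combination -h1 u v w - Complex.I * h2 u v w + Complex.I * h1 (J y u) v w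
    - h2 (J y u) v w - (-h1 v u w - Complex.I * h2 v u w + Complex.I * h1 (J y v) u w
    - h2 (J y v) u w) + (-h1 w u v - Complex.I * h2 w u v + Complex.I * h1 (J y w) u v
    - h2 (J y w) u v) + n1 u v w - Complex.I * n2 u v w - n1 u w v + Complex.I * n2 u w v
    + n1 v w u - Complex.I * n2 v w u

end Integrability

/-! ### Forms in charts: coordinate changes, `d` and `d² = 0` -/

section Charts

variable {E : Type*} [NormedAddCommGroup E] [NormedSpace ℝ E]
  {M : Type*} [TopologicalSpace M] [ChartedSpace E M] {k : ℕ}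

/-- The derivative of the preferred chart at `x₀`, as an endomorphism of the model space. -/
def dchart (x₀ z : M) : E →L[ℝ] E := mfderiv 𝓘(ℝ, E) 𝓘(ℝ, E) (chartAt E x₀) z

/-- The derivative of the inverse of the preferred chart at `x₀`, as an endomorphism of the model
space. -/
def dsymm (x₀ : M) (y : E) : E →L[ℝ] E := mfderiv 𝓘(ℝ, E) 𝓘(ℝ, E) (chartAt E x₀).symm y

/-- A form as a map into the alternating forms on the model space. -/
def CForm.val (σ : CForm E M k) (x : M) : E [⋀^Fin k]→L[ℝ] ℂ := σ x

theorem CForm.inChart_eq (σ : CForm E M k) (x₀ : M) (y : E) :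
    σ.inChart x₀ y = (σ.val ((chartAt E x₀).symm y)).compContinuousLinearMap (dsymm x₀ y) := rfl

theorem CForm.d_eq (σ : CForm E M k) (x : M) :
    σ.d.val x = (extDeriv (σ.inChart x) (chartAt E x x)).compContinuousLinearMap (dchart x x) := rfl

variable [IsManifold 𝓘(ℝ, E) ∞ M]

theorem isManifold_one : IsManifold 𝓘(ℝ, E) 1 M := IsManifold.of_le (n := ∞) (by simp)

theorem dchart_dsymm (x₀ : M) {y : E} (hy : y ∈ (chartAt E x₀).target) (v : E) :
    dchart x₀ ((chartAt E x₀).symm y) (dsymm x₀ y v) = v := by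
  have := isManifold_one (E := E) (M := M)
  exact congrArg (fun L : E →L[ℝ] E => L v)
    ((mdifferentiable_chart (I := 𝓘(ℝ, E)) x₀).comp_symm_deriv hy)

theorem dsymm_dchart (x₀ : M) {z : M} (hz : z ∈ (chartAt E x₀).source) (v : E) :
    dsymm x₀ (chartAt E x₀ z) (dchart x₀ z v) = v := by
  have := isManifold_one (E := E) (M := M)
  exact congrArg (fun L : E →L[ℝ] E => L v)
    ((mdifferentiable_chart (I := 𝓘(ℝ, E)) x₀).symm_comp_deriv hz)

theorem dchart_self (x : M) : dchart x x = ContinuousLinearMap.id ℝ E := by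
  have := isManifold_one (E := E) (M := M)
  have h := mfderiv_extChartAt_self (I := 𝓘(ℝ, E)) (x := x)
  exact h

theorem dsymm_self (x : M) : dsymm x (chartAt E x x) = ContinuousLinearMap.id ℝ E := by
  ext v
  have h := dsymm_dchart x (mem_chart_source E x) v
  rw [dchart_self] at h
  exact h

theorem CForm.d_val (σ : CForm E M k) (x : M) :
    σ.d.val x = extDeriv (σ.inChart x) (chartAt E x x) := by
  rw [CForm.d_eq, dchart_self]
  rfl

theorem minSmoothness_two_le : minSmoothness ℝ 2 ≤ (∞ : WithTop ℕ∞) := by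
  rw [minSmoothness_of_isRCLikeNormedField]
  exact WithTop.coe_le_coe.2 (le_top : (2 : ℕ∞) ≤ ⊤)

/-- The change of coordinates from the chart at `x₀` to the chart at `z`. -/
def changeChart (x₀ z : M) (y : E) : E := chartAt E z ((chartAt E x₀).symm y)

theorem contDiffAt_changeChart (x₀ z : M) {y : E} (hy : y ∈ (chartAt E x₀).target)
    (hz : (chartAt E x₀).symm y ∈ (chartAt E z).source) :
    ContDiffAt ℝ ∞ (changeChart x₀ z) y := by
  rw [← contMDiffAt_iff_contDiffAt]
  have h1 : ContMDiffAt 𝓘(ℝ, E) 𝓘(ℝ, E) ∞ (chartAt E x₀).symm y :=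
    (contMDiffOn_chart_symm (I := 𝓘(ℝ, E)) (x := x₀)).contMDiffAt
      ((chartAt E x₀).open_target.mem_nhds hy)
  have h2 : ContMDiffAt 𝓘(ℝ, E) 𝓘(ℝ, E) ∞ (chartAt E z) ((chartAt E x₀).symm y) :=
    (contMDiffOn_chart (I := 𝓘(ℝ, E)) (x := z)).contMDiffAt
      ((chartAt E z).open_source.mem_nhds hz)
  exact h2.comp y h1

theorem fderiv_changeChart (x₀ z : M) {y : E} (hy : y ∈ (chartAt E x₀).target)
    (hz : (chartAt E x₀).symm y ∈ (chartAt E z).source) :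
    fderiv ℝ (changeChart x₀ z) y =
      (dchart z ((chartAt E x₀).symm y)).comp (dsymm x₀ y) := by
  have := isManifold_one (E := E) (M := M)
  rw [← mfderiv_eq_fderiv]
  exact mfderiv_comp y ((mdifferentiable_chart (I := 𝓘(ℝ, E)) z).mdifferentiableAt hz)
    ((mdifferentiable_chart (I := 𝓘(ℝ, E)) x₀).mdifferentiableAt_symm hy)

theorem CForm.inChart_changeChart (σ : CForm E M k) (x₀ z : M) {y : E}
    (hy : y ∈ (chartAt E x₀).target) (hz : (chartAt E x₀).symm y ∈ (chartAt E z).source) :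
    σ.inChart x₀ y = (σ.inChart z (changeChart x₀ z y)).compContinuousLinearMap
      (fderiv ℝ (changeChart x₀ z) y) := by
  rw [fderiv_changeChart x₀ z hy hz, CForm.inChart_eq, CForm.inChart_eq]
  ext v
  simp only [ContinuousAlternatingMap.compContinuousLinearMap_apply, changeChart,
    (chartAt E z).left_inv hz]
  congr 1
  funext i
  exact (dsymm_dchart z hz _).symm

/-- The exterior derivative of differential forms on `M` is computed in every preferred chart. -/
theorem CForm.IsSmooth.inChart_d {σ : CForm E M k} (hσ : σ.IsSmooth) (x₀ : M) {y : E}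
    (hy : y ∈ (chartAt E x₀).target) :
    σ.d.inChart x₀ y = extDeriv (σ.inChart x₀) y := by
  -- By definition `d` at the point `z` is computed in the preferred chart at `z`. Only two charts
  -- have to be compared, and `extDeriv` commutes with pullback along the transition map.
  set z := (chartAt E x₀).symm y with hz
  have hzs : (chartAt E x₀).symm y ∈ (chartAt E z).source := mem_chart_source E z
  have hev : σ.inChart x₀ =ᶠ[𝓝 y] fun y' =>
      (σ.inChart z (changeChart x₀ z y')).compContinuousLinearMap
        (fderiv ℝ (changeChart x₀ z) y') := by
    have h1 := (chartAt E x₀).open_target.mem_nhds hy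
    have h2 : ∀ᶠ y' in 𝓝 y, (chartAt E x₀).symm y' ∈ (chartAt E z).source :=
      ((chartAt E x₀).continuousAt_symm hy).eventually ((chartAt E z).open_source.mem_nhds hzs)
    filter_upwards [h1, h2] with y' h1' h2'
    exact σ.inChart_changeChart x₀ z h1' h2'
  have hd : DifferentiableAt ℝ (σ.inChart z) (changeChart x₀ z y) := hσ.differentiableAt z
  rw [hev.extDeriv_eq, extDeriv_pullback hd (contDiffAt_changeChart x₀ z hy hzs)
    minSmoothness_two_le, fderiv_changeChart x₀ z hy hzs, CForm.inChart_eq, ← hz, CForm.d_eq]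
  rfl

theorem CForm.IsSmooth.d {σ : CForm E M k} (hσ : σ.IsSmooth) : σ.d.IsSmooth := by
  intro x₀
  have h : ContDiffOn ℝ ∞ (fun y => extDeriv (σ.inChart x₀) y) (chartAt E x₀).target := by
    have h1 : ContDiffOn ℝ ∞ (fderiv ℝ (σ.inChart x₀)) (chartAt E x₀).target :=
      (hσ x₀).fderiv_of_isOpen (chartAt E x₀).open_target (by simp)
    exact (ContinuousAlternatingMap.alternatizeUncurryFinCLM ℝ E ℂ).contDiff.comp_contDiffOn h1
  exact h.congr fun y hy => hσ.inChart_d x₀ hy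

theorem CForm.IsSmooth.d_d {σ : CForm E M k} (hσ : σ.IsSmooth) : σ.d.d = 0 := by
  funext x
  show σ.d.d.val x = 0
  rw [CForm.d_val]
  have hev : σ.d.inChart x =ᶠ[𝓝 (chartAt E x x)] extDeriv (σ.inChart x) := by
    filter_upwards [(chartAt E x).open_target.mem_nhds (mem_chart_target E x)] with y hy
    exact hσ.inChart_d x hy
  rw [hev.extDeriv_eq]
  exact extDeriv_extDeriv_apply (r := ∞) ((hσ x).contDiffAt
    ((chartAt E x).open_target.mem_nhds (mem_chart_target E x))) minSmoothness_two_le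

/-- A field of endomorphisms as a map into the endomorphisms of the model space. -/
def endVal (J : EndField E M) (x : M) : E →L[ℝ] E := J x

/-- The coordinate expression of a field of endomorphisms in the preferred chart at `x₀`. -/
def endInChart (J : EndField E M) (x₀ : M) (y : E) : E →L[ℝ] E :=
  (dchart x₀ ((chartAt E x₀).symm y)).comp
    ((endVal J ((chartAt E x₀).symm y)).comp (dsymm x₀ y))

end Charts

/-! ### Naturality and smoothness of the type projections -/

section TypePartSmooth

variable {E : Type*} [NormedAddCommGroup E] [NormedSpace ℝ E] {k : ℕ}

theorem typePart_compContinuousLinearMap {J J' A : E →L[ℝ] E} (h : ∀ v, J (A v) = A (J' v))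
    (p q : ℕ) (σ : E [⋀^Fin k]→L[ℝ] ℂ) :
    typePart J' p q (σ.compContinuousLinearMap A) =
      (typePart J p q σ).compContinuousLinearMap A := by
  ext v
  simp only [ContinuousAlternatingMap.compContinuousLinearMap_apply, typePart_apply,
    slotPart_apply]
  refine Finset.sum_congr rfl fun B _ => congrArg _ (Finset.sum_congr rfl fun S _ =>
    congrArg _ (congrArg σ (funext fun i => ?_)))
  simp only [Function.comp]
  split_ifs <;> simp [h]

variable [FiniteDimensional ℝ E]

instance finiteDimensional_continuousMultilinearMap :
    FiniteDimensional ℝ (ContinuousMultilinearMap ℝ (fun _ : Fin k => E) ℂ) :=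
  Module.Finite.of_injective
    (ContinuousMultilinearMap.toMultilinearMapLinear : ContinuousMultilinearMap ℝ
      (fun _ : Fin k => E) ℂ →ₗ[ℝ] MultilinearMap ℝ (fun _ : Fin k => E) ℂ)
    ContinuousMultilinearMap.toMultilinearMap_injective

/-- The inclusion of alternating into multilinear maps has a linear left inverse, continuous because
the spaces are finite-dimensional. -/
theorem contDiffOn_of_toContinuousMultilinearMap {X : Type*} [NormedAddCommGroup X]
    [NormedSpace ℝ X] {f : X → E [⋀^Fin k]→L[ℝ] ℂ} {s : Set X}
    (h : ContDiffOn ℝ ∞ (fun x => (f x).toContinuousMultilinearMap) s) : ContDiffOn ℝ ∞ f s := by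
  obtain ⟨g, hg⟩ := LinearMap.exists_leftInverse_of_injective
    (ContinuousAlternatingMap.toContinuousMultilinearMapLinear (R := ℝ) (A := ℝ) (M := E) (N := ℂ)
      (ι := Fin k))
    (LinearMap.ker_eq_bot.2 ContinuousAlternatingMap.toContinuousMultilinearMap_injective)
  have h1 := (LinearMap.toContinuousLinearMap g).contDiff.comp_contDiffOn h
  exact h1.congr fun x _ => (congrArg (fun L => L (f x)) hg).symm

/-- The projection is linear in `σ` and polynomial in `J`. -/
theorem contDiffOn_typePart {X : Type*} [NormedAddCommGroup X] [NormedSpace ℝ X]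
    {J : X → E →L[ℝ] E} {σ : X → E [⋀^Fin k]→L[ℝ] ℂ} {s : Set X} (hJ : ContDiffOn ℝ ∞ J s)
    (hσ : ContDiffOn ℝ ∞ σ s) (p q : ℕ) :
    ContDiffOn ℝ ∞ (fun x => typePart (J x) p q (σ x)) s := by
  apply contDiffOn_of_toContinuousMultilinearMap
  have hins (S : Finset (Fin k)) : ContDiffOn ℝ ∞ (fun x => insertJ (J x) S (σ x)) s := by
    have h1 : ContDiffOn ℝ ∞ (fun x => (σ x).toContinuousMultilinearMap) s :=
      (ContinuousAlternatingMap.toContinuousMultilinearMapCLM (𝕜 := ℝ) (E := E) (F := ℂ)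
        (ι := Fin k) ℝ).contDiff.comp_contDiffOn hσ
    have h2 : ContDiffOn ℝ ∞ (fun x => fun i : Fin k =>
        if i ∈ S then J x else ContinuousLinearMap.id ℝ E) s := by
      rw [contDiffOn_pi]
      intro i
      split_ifs
      exacts [hJ, contDiffOn_const]
    have h3 := (ContinuousMultilinearMap.contDiff (E := fun _ : Fin k => E →L[ℝ] E)
      (F := ContinuousMultilinearMap ℝ (fun _ : Fin k => E) ℂ →L[ℝ]
        ContinuousMultilinearMap ℝ (fun _ : Fin k => E) ℂ)
      (ContinuousMultilinearMap.compContinuousLinearMapContinuousMultilinear ℝ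
        (fun _ : Fin k => E) (fun _ : Fin k => E) ℂ) (n := ∞)).comp_contDiffOn h2
    exact h3.clm_apply h1
  show ContDiffOn ℝ ∞ (fun x => typePartAux (J x) p q (σ x)) s
  simp only [typePartAux, slotPart]
  exact ContDiffOn.sum fun A _ => (ContDiffOn.sum fun S _ => (hins S).const_smul _).const_smul _

end TypePartSmooth

/-! ### Endomorphism fields in charts -/

section Charts

variable {E : Type*} [NormedAddCommGroup E] [NormedSpace ℝ E]
  {M : Type*} [TopologicalSpace M] [ChartedSpace E M] {k : ℕ} [IsManifold 𝓘(ℝ, E) ∞ M]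

theorem dsymm_endInChart (J : EndField E M) (x₀ : M) {y : E} (hy : y ∈ (chartAt E x₀).target)
    (v : E) : dsymm x₀ y (endInChart J x₀ y v) =
      endVal J ((chartAt E x₀).symm y) (dsymm x₀ y v) := by
  have h := dsymm_dchart x₀ ((chartAt E x₀).map_target hy)
    (endVal J ((chartAt E x₀).symm y) (dsymm x₀ y v))
  rw [(chartAt E x₀).right_inv hy] at h
  exact h

theorem endInChart_sq {J : EndField E M}
    (hJ : ∀ (x : M) (v : TangentSpace 𝓘(ℝ, E) x), J x (J x v) = -v) (x₀ : M) {y : E}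
    (hy : y ∈ (chartAt E x₀).target) (v : E) :
    endInChart J x₀ y (endInChart J x₀ y v) = -v := by
  have h1 : endInChart J x₀ y (endInChart J x₀ y v) = dchart x₀ ((chartAt E x₀).symm y)
    (endVal J ((chartAt E x₀).symm y) (dsymm x₀ y (endInChart J x₀ y v))) := rfl
  rw [h1, dsymm_endInChart J x₀ hy]
  have h2 : endVal J ((chartAt E x₀).symm y) (endVal J ((chartAt E x₀).symm y)
      (dsymm x₀ y v)) = -(dsymm x₀ y v) := hJ _ _
  rw [h2, ContinuousLinearMap.map_neg, dchart_dsymm x₀ hy]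

theorem endInChart_self (J : EndField E M) (x : M) :
    endInChart J x (chartAt E x x) = endVal J x := by
  rw [endInChart, dsymm_self, (chartAt E x).left_inv (mem_chart_source E x), dchart_self]
  rfl

theorem inChart_proj (J : EndField E M) (p q : ℕ) (σ : CForm E M k) (x₀ : M) {y : E}
    (hy : y ∈ (chartAt E x₀).target) :
    (proj J p q σ).inChart x₀ y = typePart (endInChart J x₀ y) p q (σ.inChart x₀ y) :=
  (typePart_compContinuousLinearMap (fun v => (dsymm_endInChart J x₀ hy v).symm) p q
    (σ.val ((chartAt E x₀).symm y))).symm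

/-- Smoothness of `J` as a section is expressed in trivializations of the endomorphism bundle; this
identifies them with the coordinate expression in a chart. -/
theorem endInChart_eq_inCoordinates (J : EndField E M) (x₀ : M) {z : M}
    (hz : z ∈ (chartAt E x₀).source) :
    endInChart J x₀ (chartAt E x₀ z) = ContinuousLinearMap.inCoordinates E
      (TangentSpace 𝓘(ℝ, E)) E (TangentSpace 𝓘(ℝ, E)) x₀ z x₀ z (J z) := by
  have := isManifold_one (E := E) (M := M)
  rw [ContinuousLinearMap.inCoordinates, TangentBundle.continuousLinearMapAt_trivializationAt hz,
    TangentBundle.symmL_trivializationAt hz, endInChart, (chartAt E x₀).left_inv hz]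
  simp only [modelWithCornersSelf_coe, Set.range_id, mfderivWithin_univ]
  rfl

/-- The coordinate expression of a smooth family of endomorphism fields is smooth in the
parameter and the coordinates. -/
theorem contDiffOn_endInChart {U : Set ℝ} {J : ℝ → EndField E M}
    (hJ : ContMDiffOn (𝓘(ℝ, ℝ).prod 𝓘(ℝ, E)) (𝓘(ℝ, E).prod 𝓘(ℝ, E →L[ℝ] E)) ∞
      (fun p : ℝ × M => Bundle.TotalSpace.mk' (E →L[ℝ] E)
        (E := fun x : M => TangentSpace 𝓘(ℝ, E) x →L[ℝ] TangentSpace 𝓘(ℝ, E) x) p.2 (J p.1 p.2))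
      (U ×ˢ Set.univ)) (x₀ : M) :
    ContDiffOn ℝ ∞ (fun p : ℝ × E => endInChart (J p.1) x₀ p.2)
      (U ×ˢ (chartAt E x₀).target) := by
  have := isManifold_one (E := E) (M := M)
  let e := trivializationAt (E →L[ℝ] E)
    (fun x : M => TangentSpace 𝓘(ℝ, E) x →L[ℝ] TangentSpace 𝓘(ℝ, E) x) x₀
  have h1 : ContMDiffOn (𝓘(ℝ, ℝ).prod 𝓘(ℝ, E)) 𝓘(ℝ, E →L[ℝ] E) ∞
      (fun p : ℝ × M => (e (Bundle.TotalSpace.mk' (E →L[ℝ] E)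
        (E := fun x : M => TangentSpace 𝓘(ℝ, E) x →L[ℝ] TangentSpace 𝓘(ℝ, E) x)
          p.2 (J p.1 p.2))).2) (U ×ˢ (chartAt E x₀).source) := by
    refine ((e.contMDiffOn_iff (IB := 𝓘(ℝ, E)) ?_).1 (hJ.mono (Set.prod_mono_right
      (Set.subset_univ _)))).2
    rintro ⟨t, z⟩ ⟨-, hz⟩
    simpa [e, Bundle.Trivialization.mem_source] using hz
  have h2 : ContMDiffOn 𝓘(ℝ, ℝ × E) (𝓘(ℝ, ℝ).prod 𝓘(ℝ, E)) ∞
      (fun p : ℝ × E => (p.1, (chartAt E x₀).symm p.2)) (U ×ˢ (chartAt E x₀).target) := by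
    refine contDiff_fst.contMDiff.contMDiffOn.prodMk ?_
    exact (contMDiffOn_chart_symm (I := 𝓘(ℝ, E)) (x := x₀)).comp contDiff_snd.contMDiff.contMDiffOn
      fun p hp => hp.2
  have h3 := h1.comp h2 fun p hp => ⟨hp.1, (chartAt E x₀).map_target hp.2⟩
  refine h3.contDiffOn.congr fun p hp => ?_
  have h4 := endInChart_eq_inCoordinates (J p.1) x₀ ((chartAt E x₀).map_target hp.2)
  rw [(chartAt E x₀).right_inv hp.2] at h4
  exact h4

end Charts

/-! ### From Lie brackets to the Nijenhuis tensor -/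

section LieBracket

variable {E : Type*} [NormedAddCommGroup E] [NormedSpace ℝ E]
  {M : Type*} [TopologicalSpace M] [ChartedSpace E M] [IsManifold 𝓘(ℝ, E) ∞ M]

theorem mpullbackWithin_extChartAt_symm (V : (x : M) → TangentSpace 𝓘(ℝ, E) x) (x : M)
    {y : E} (hy : y ∈ (chartAt E x).target) {v : E}
    (hv : (V ((chartAt E x).symm y) : E) = dsymm x y v) :
    (VectorField.mpullbackWithin 𝓘(ℝ, E) 𝓘(ℝ, E) (extChartAt 𝓘(ℝ, E) x).symm V
      (Set.range 𝓘(ℝ, E)) y : E) = v := by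
  have h1 : mfderivWithin 𝓘(ℝ, E) 𝓘(ℝ, E) (extChartAt 𝓘(ℝ, E) x).symm (Set.range 𝓘(ℝ, E)) y
      = dsymm x y := by
    simp only [modelWithCornersSelf_coe, Set.range_id, mfderivWithin_univ]
    rfl
  have h2 : (VectorField.mpullbackWithin 𝓘(ℝ, E) 𝓘(ℝ, E) (extChartAt 𝓘(ℝ, E) x).symm V
      (Set.range 𝓘(ℝ, E)) y : E) = (dsymm x y).inverse (V ((chartAt E x).symm y) : E) := by
    rw [VectorField.mpullbackWithin_apply, h1]
    rfl
  have hl : Function.LeftInverse (dchart x ((chartAt E x).symm y)) (dsymm x y) :=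
    fun u => dchart_dsymm x hy u
  have hr : Function.RightInverse (dchart x ((chartAt E x).symm y)) (dsymm x y) := fun u => by
    have h := dsymm_dchart x ((chartAt E x).map_target hy) u
    rwa [(chartAt E x).right_inv hy] at h
  have h3 : dsymm x y = (ContinuousLinearEquiv.equivOfInverse (dsymm x y)
    (dchart x ((chartAt E x).symm y)) hl hr : E →L[ℝ] E) := rfl
  rw [h2, hv, h3, ContinuousLinearMap.inverse_equiv]
  exact (ContinuousLinearEquiv.equivOfInverse (dsymm x y)
    (dchart x ((chartAt E x).symm y)) hl hr).symm_apply_apply v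

/-- The bracket depends only on germs and is computed in the chart at `x`, whose derivative at `x`
is the identity, so no correction factor appears. -/
theorem mlieBracket_eq_of_eventually {V W : (x : M) → TangentSpace 𝓘(ℝ, E) x} {x : M}
    {v w : E → E}
    (hV : ∀ᶠ y in 𝓝 (chartAt E x x), (V ((chartAt E x).symm y) : E) = dsymm x y (v y))
    (hW : ∀ᶠ y in 𝓝 (chartAt E x x), (W ((chartAt E x).symm y) : E) = dsymm x y (w y)) :
    (VectorField.mlieBracket 𝓘(ℝ, E) V W x : E) =
      fderiv ℝ w (chartAt E x x) (v (chartAt E x x))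
        - fderiv ℝ v (chartAt E x x) (w (chartAt E x x)) := by
  have := isManifold_one (E := E) (M := M)
  have ht := (chartAt E x).open_target.mem_nhds (mem_chart_target E x)
  have hV' : (VectorField.mpullbackWithin 𝓘(ℝ, E) 𝓘(ℝ, E) (extChartAt 𝓘(ℝ, E) x).symm V
      (Set.range 𝓘(ℝ, E)) : E → E) =ᶠ[𝓝 (chartAt E x x)] v := by
    filter_upwards [hV, ht] with y h1 h2
    exact mpullbackWithin_extChartAt_symm V x h2 h1
  have hW' : (VectorField.mpullbackWithin 𝓘(ℝ, E) 𝓘(ℝ, E) (extChartAt 𝓘(ℝ, E) x).symm W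
      (Set.range 𝓘(ℝ, E)) : E → E) =ᶠ[𝓝 (chartAt E x x)] w := by
    filter_upwards [hW, ht] with y h1 h2
    exact mpullbackWithin_extChartAt_symm W x h2 h1
  rw [← VectorField.mlieBracketWithin_univ, VectorField.mlieBracketWithin_apply,
    mfderiv_extChartAt_self]
  have hid : (ContinuousLinearMap.id ℝ E).inverse = ContinuousLinearMap.id ℝ E :=
    ContinuousLinearMap.inverse_id
  have hset : (extChartAt 𝓘(ℝ, E) x).symm ⁻¹' (Set.univ : Set M) ∩ Set.range 𝓘(ℝ, E)
      = Set.univ := by simp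
  rw [hset]
  have h3 := hV'.lieBracket_vectorField_eq (𝕜 := ℝ) hW'
  refine (congrArg (fun L : E →L[ℝ] E => L _) hid).trans ?_
  exact (congrFun VectorField.lieBracketWithin_univ (chartAt E x x)).trans h3

variable [FiniteDimensional ℝ E] [T2Space M]

/-- Integrability is a condition on global fields, so a field with constant coordinates near `x` is
cut off by a bump function equal to one near `x`. -/
theorem exists_smooth_vectorField (x : M) (v : E) :
    ∃ X : (x : M) → TangentSpace 𝓘(ℝ, E) x, IsSmoothVectorField X ∧
      ∀ᶠ y in 𝓝 (chartAt E x x), (X ((chartAt E x).symm y) : E) = dsymm x y v := by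
  have := isManifold_one (E := E) (M := M)
  let s : (z : M) → TangentSpace 𝓘(ℝ, E) z := fun z => dsymm x (chartAt E x z) v
  let e := trivializationAt E (TangentSpace 𝓘(ℝ, E) : M → Type _) x
  have hs : ContMDiffOn 𝓘(ℝ, E) (𝓘(ℝ, E).prod 𝓘(ℝ, E)) ∞
      (fun z => Bundle.TotalSpace.mk' E z (s z)) (chartAt E x).source := by
    refine (e.contMDiffOn_iff (IB := 𝓘(ℝ, E)) ?_).2 ⟨contMDiffOn_id, ?_⟩
    · intro z hz
      simpa [e, Bundle.Trivialization.mem_source] using hz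
    · refine contMDiffOn_const (c := v) |>.congr fun z hz => ?_
      have h1 : (e (Bundle.TotalSpace.mk' E z (s z))).2 = e.continuousLinearMapAt ℝ z (s z) := by
        rw [Bundle.Trivialization.continuousLinearMapAt_apply,
          Bundle.Trivialization.linearMapAt_apply, if_pos (by simpa [e] using hz)]
      rw [h1, TangentBundle.continuousLinearMapAt_trivializationAt hz]
      have h2 := dchart_dsymm x ((chartAt E x).map_source hz) v
      rw [(chartAt E x).left_inv hz] at h2
      exact h2
  obtain ⟨ρ⟩ : Nonempty (SmoothBumpFunction 𝓘(ℝ, E) x) := inferInstance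
  refine ⟨(ρ : M → ℝ) • s, ?_, ?_⟩
  · exact ContMDiffOn.smul_section_of_tsupport ρ.contMDiff.contMDiffOn (chartAt E x).open_source
      ρ.tsupport_subset_chartAt_source hs
  · have h1 : ∀ᶠ y in 𝓝 (chartAt E x x), ρ ((chartAt E x).symm y) = 1 := by
      have h2 : Filter.Tendsto (chartAt E x).symm (𝓝 (chartAt E x x)) (𝓝 x) := by
        have h3 := (chartAt E x).continuousAt_symm (mem_chart_target E x)
        rwa [ContinuousAt, (chartAt E x).left_inv (mem_chart_source E x)] at h3
      exact h2.eventually ρ.eventuallyEq_one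
    filter_upwards [h1, (chartAt E x).open_target.mem_nhds (mem_chart_target E x)] with y h1 h2
    have h3 : (((ρ : M → ℝ) • s) ((chartAt E x).symm y) : E) =
      ρ ((chartAt E x).symm y) • dsymm x (chartAt E x ((chartAt E x).symm y)) v := rfl
    rw [h3, h1, one_smul, (chartAt E x).right_inv h2]

/-- Test integrability on fields that are constant in coordinates near `x`: then `[X, Y] = 0` there,
and the other brackets contain only derivatives of `J`. -/
theorem IsComplexStructure.nijenhuisVanishes {J : EndField E M} (hJ : IsComplexStructure J)
    (x : M) (hd : DifferentiableAt ℝ (endInChart J x) (chartAt E x x)) :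
    NijenhuisVanishes (endInChart J x) (chartAt E x x) := by
  intro v w
  obtain ⟨X, hX, hX'⟩ := exists_smooth_vectorField x v
  obtain ⟨Y, hY, hY'⟩ := exists_smooth_vectorField x w
  have ht := (chartAt E x).open_target.mem_nhds (mem_chart_target E x)
  have hJX : ∀ᶠ y in 𝓝 (chartAt E x x), (J _ (X ((chartAt E x).symm y)) : E) =
      dsymm x y (endInChart J x y v) := by
    filter_upwards [hX', ht] with y h1 h2
    rw [dsymm_endInChart J x h2, ← h1]
    rfl
  have hJY : ∀ᶠ y in 𝓝 (chartAt E x x), (J _ (Y ((chartAt E x).symm y)) : E) =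
      dsymm x y (endInChart J x y w) := by
    filter_upwards [hY', ht] with y h1 h2
    rw [dsymm_endInChart J x h2, ← h1]
    rfl
  have e1 := mlieBracket_eq_of_eventually (V := fun x => J x (X x)) (W := fun x => J x (Y x))
    (v := fun y => endInChart J x y v) (w := fun y => endInChart J x y w) hJX hJY
  have e2 := mlieBracket_eq_of_eventually (V := X) (W := Y)
    (v := fun _ => v) (w := fun _ => w) hX' hY'
  have e3 := mlieBracket_eq_of_eventually (V := fun x => J x (X x)) (W := Y)
    (v := fun y => endInChart J x y v) (w := fun _ => w) hJX hY'
  have e4 := mlieBracket_eq_of_eventually (V := X) (W := fun x => J x (Y x))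
    (v := fun _ => v) (w := fun y => endInChart J x y w) hX' hJY
  obtain ⟨A, hA⟩ : ∃ A : E, A = VectorField.mlieBracket 𝓘(ℝ, E) (fun x => J x (X x))
    (fun x => J x (Y x)) x := ⟨_, rfl⟩
  obtain ⟨B, hB⟩ : ∃ B : E, B = VectorField.mlieBracket 𝓘(ℝ, E) X Y x := ⟨_, rfl⟩
  obtain ⟨C, hC⟩ : ∃ C : E, C = VectorField.mlieBracket 𝓘(ℝ, E) (fun x => J x (X x)) Y x :=
    ⟨_, rfl⟩
  obtain ⟨D, hD⟩ : ∃ D : E, D = VectorField.mlieBracket 𝓘(ℝ, E) X (fun x => J x (Y x)) x :=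
    ⟨_, rfl⟩
  have hN : A = B + endVal J x C + endVal J x D := by
    rw [hA, hB, hC, hD]
    exact hJ.integrable X Y hX hY x
  rw [hA.trans e1, hB.trans e2, hC.trans e3, hD.trans e4, ← endInChart_self] at hN
  have hfd (u : E) : fderiv ℝ (fun y => endInChart J x y u) (chartAt E x x) =
    (fderiv ℝ (endInChart J x) (chartAt E x x)).flip u := (hasFDerivAt_clm_apply_const hd u).fderiv
  simp only [hfd, ContinuousLinearMap.flip_apply, fderiv_fun_const, Pi.zero_apply,
    zero_apply, sub_zero, zero_sub, zero_add, map_neg] at hN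
  rw [sub_eq_iff_eq_add] at hN
  rw [hN]
  abel

end LieBracket

/-! ### Global bidegree arguments and closedness -/

section Projections

variable {E : Type*} [NormedAddCommGroup E] [NormedSpace ℝ E]
  {M : Type*} [TopologicalSpace M] [ChartedSpace E M] {k : ℕ}

theorem proj_add (J : EndField E M) (p q : ℕ) (σ τ : CForm E M k) :
    proj J p q (σ + τ) = proj J p q σ + proj J p q τ :=
  funext fun x => typePart_add (J x) p q (σ x) (τ x)

theorem proj_sum_two (J : EndField E M) (σ : CForm E M 2) :
    proj J 2 0 σ + proj J 1 1 σ + proj J 0 2 σ = σ :=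
  funext fun x => typePart_sum_two (J x) (σ x)

theorem proj_sum_one (J : EndField E M) (σ : CForm E M 1) : proj J 1 0 σ + proj J 0 1 σ = σ :=
  funext fun x => typePart_sum_one (J x) (σ x)

/-- `del` and `delbar` sum over all bidegrees; on a `(1,0)`-form, and then on the resulting
`(1,1)`-form, a single summand survives. -/
theorem del_delbar_proj_one_zero {J : EndField E M}
    (hsq : ∀ (x : M) (v : TangentSpace 𝓘(ℝ, E) x), J x (J x v) = -v) (γ : CForm E M 1) :
    del J (delbar J (proj J 1 0 γ)) =
      proj J 2 1 (proj J 1 1 (proj J 1 0 γ).d).d := by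
  have a1 : proj J 0 1 (proj J 1 0 γ) = 0 :=
    funext fun x => typePart_zero_one_one_zero (hsq x) (γ x)
  have a2 : proj J 1 0 (proj J 1 0 γ) = proj J 1 0 γ :=
    funext fun x => typePart_one_zero_idem (hsq x) (γ x)
  have z (l p q : ℕ) : proj J p q (0 : CForm E M l) = 0 := by
    have h := proj_add J p q (0 : CForm E M l) 0
    rwa [add_zero, left_eq_add] at h
  have e1 : Finset.HasAntidiagonal.antidiagonal 1 = {((0 : ℕ), (1 : ℕ)), (1, 0)} := rfl
  have e2 : Finset.HasAntidiagonal.antidiagonal 2 =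
    {((0 : ℕ), (2 : ℕ)), (1, 1), (2, 0)} := rfl
  have b : delbar J (proj J 1 0 γ) = proj J 1 1 (proj J 1 0 γ).d := by
    rw [delbar, e1, Finset.sum_pair (by decide)]
    simp only [a1, a2, CForm.d_zero, z, zero_add]
  rw [b]
  generalize (proj J 1 0 γ).d = τ
  have c1 : proj J 0 2 (proj J 1 1 τ) = 0 :=
    funext fun x => typePart_zero_two_one_one (hsq x) (τ x)
  have c2 : proj J 2 0 (proj J 1 1 τ) = 0 :=
    funext fun x => typePart_two_zero_one_one (hsq x) (τ x)
  have c3 : proj J 1 1 (proj J 1 1 τ) = proj J 1 1 τ :=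
    funext fun x => typePart_one_one_idem (hsq x) (τ x)
  rw [del, e2, Finset.sum_insert (by decide), Finset.sum_pair (by decide)]
  simp only [c1, c2, c3, CForm.d_zero, z, zero_add, add_zero]

variable [IsManifold 𝓘(ℝ, E) ∞ M] [FiniteDimensional ℝ E]

theorem isSmooth_proj {J : EndField E M}
    (hJ : ∀ x₀ : M, ContDiffOn ℝ ∞ (endInChart J x₀) (chartAt E x₀).target) {σ : CForm E M k}
    (hσ : σ.IsSmooth) (p q : ℕ) : (proj J p q σ).IsSmooth := fun x₀ =>
  (contDiffOn_typePart (hJ x₀) (hσ x₀) p q).congr fun _ hy => inChart_proj J p q σ x₀ hy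

variable [T2Space M] {J : EndField E M} (hJ : IsComplexStructure J)
  (hs : ∀ x₀ : M, ContDiffOn ℝ ∞ (endInChart J x₀) (chartAt E x₀).target)

include hJ hs

theorem differentiableAt_and_nijenhuisVanishes (x : M) :
    DifferentiableAt ℝ (endInChart J x) (chartAt E x x) ∧
      NijenhuisVanishes (endInChart J x) (chartAt E x x) := by
  have hd : DifferentiableAt ℝ (endInChart J x) (chartAt E x x) :=
    ((hs x).contDiffAt ((chartAt E x).open_target.mem_nhds
      (mem_chart_target E x))).differentiableAt (by simp)
  exact ⟨hd, hJ.nijenhuisVanishes x hd⟩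

theorem proj_zero_two_d_proj_one_zero {σ : CForm E M 1} (hσ : σ.IsSmooth) :
    proj J 0 2 (proj J 1 0 σ).d = 0 := by
  funext x
  obtain ⟨hd, hN⟩ := differentiableAt_and_nijenhuisVanishes hJ hs x
  show typePart (endVal J x) 0 2 ((proj J 1 0 σ).d.val x) = 0
  rw [CForm.d_val, ← endInChart_self]
  refine typePart_zero_two_extDeriv hd hN ((isSmooth_proj hs hσ 1 0).differentiableAt x) ?_
  filter_upwards [(chartAt E x).open_target.mem_nhds (mem_chart_target E x)] with y hy v
  rw [inChart_proj J 1 0 σ x hy]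
  exact typePart_one_zero_map (endInChart_sq hJ.sq_eq x hy) _ v

theorem proj_two_zero_d_proj_zero_one {σ : CForm E M 1} (hσ : σ.IsSmooth) :
    proj J 2 0 (proj J 0 1 σ).d = 0 := by
  funext x
  obtain ⟨hd, hN⟩ := differentiableAt_and_nijenhuisVanishes hJ hs x
  show typePart (endVal J x) 2 0 ((proj J 0 1 σ).d.val x) = 0
  rw [CForm.d_val, ← endInChart_self]
  refine typePart_two_zero_extDeriv hd hN ((isSmooth_proj hs hσ 0 1).differentiableAt x) ?_
  filter_upwards [(chartAt E x).open_target.mem_nhds (mem_chart_target E x)] with y hy v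
  rw [inChart_proj J 0 1 σ x hy]
  exact typePart_zero_one_map (endInChart_sq hJ.sq_eq x hy) _ v

/-- A `(2,0)`-form `κ` is closed when `dκ = -dβ` for a `(1,1)`-form `β` with `∂β = 0`. -/
theorem isClosed_of_d_add_d_eq_zero {σ τ : CForm E M 2} (hσ : σ.IsSmooth) (hτ : τ.IsSmooth)
    (h : (proj J 2 0 σ).d + (proj J 1 1 τ).d = 0) (hτ' : proj J 2 1 (proj J 1 1 τ).d = 0) :
    (proj J 2 0 σ).IsClosed := by
  -- Both derivatives are the same 3-form up to sign, so it suffices that the one coming from the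
  -- `(1,1)`-form vanishes.
  suffices hβ : (proj J 1 1 τ).d = 0 by
    rwa [hβ, add_zero] at h
  funext x
  obtain ⟨hd, hN⟩ := differentiableAt_and_nijenhuisVanishes hJ hs x
  have hnhds := (chartAt E x).open_target.mem_nhds (mem_chart_target E x)
  have h11 := extDeriv_one_one hd hN ((isSmooth_proj hs hτ 1 1).differentiableAt x)
    (by
      filter_upwards [hnhds] with y hy v w
      rw [inChart_proj J 1 1 τ x hy]
      exact typePart_one_one_map (endInChart_sq hJ.sq_eq x hy) _ v w)
    (by
      filter_upwards [hnhds] with y hy v w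
      rw [inChart_proj J 1 1 τ x hy]
      exact typePart_one_one_map_swap (endInChart_sq hJ.sq_eq x hy) _ v w)
  have h20 := extDeriv_two_zero hd hN ((isSmooth_proj hs hσ 2 0).differentiableAt x)
    (by
      filter_upwards [hnhds] with y hy v w
      rw [inChart_proj J 2 0 σ x hy]
      exact typePart_two_zero_map_left (endInChart_sq hJ.sq_eq x hy) _ v w)
  have h21 : typePart (endVal J x) 2 1 ((proj J 1 1 τ).d.val x) = 0 := congrFun hτ' x
  have hsum : (proj J 2 0 σ).d.val x + (proj J 1 1 τ).d.val x = 0 := congrFun h x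
  rw [← CForm.d_val, endInChart_self] at h11 h20
  -- The information on `d` of the `(2,0)`-form is carried over to `d` of the `(1,1)`-form, which
  -- supplies the vanishing of its `(1,2)`- and `(0,3)`-parts.
  rw [eq_neg_of_add_eq_zero_left hsum] at h20
  show (proj J 1 1 τ).d.val x = 0
  refine three_form_eq_zero (V := E) _ h11 h21 fun u v w => ?_
  have h := h20 u v w
  simp only [ContinuousAlternatingMap.neg_apply] at h
  linear_combination -h

/-- With `η = π^{1,0}γ`, the `(2,0)`-part of `σ` is `π^{2,0}dη + α₂₀`. The first term is closed by
`isClosed_of_d_add_d_eq_zero`, applied with both forms equal to `dη`. -/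
theorem isClosed_proj_two_zero {σ : CForm E M 2} {γ : CForm E M 1} (hγ : γ ∈ Delta J σ)
    (hdd : del J (delbar J (proj J 1 0 γ)) = 0) : (proj J 2 0 σ).IsClosed := by
  obtain ⟨hγs, α₂₀, α₁₁, α₀₂, ⟨⟨hα, hα20⟩, hαc⟩, ⟨⟨-, hα11⟩, -⟩, ⟨⟨-, hα02⟩, -⟩, hd⟩ := hγ
  rw [del_delbar_proj_one_zero hJ.sq_eq] at hdd
  set η := proj J 1 0 γ with hη
  have hηs : η.IsSmooth := isSmooth_proj hs hγs 1 0
  have hη' : (proj J 0 1 γ).IsSmooth := isSmooth_proj hs hγs 0 1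
  have hκs := isSmooth_proj hs hηs.d 2 0
  have hβs := isSmooth_proj hs hηs.d 1 1
  have hηd : η.d = proj J 2 0 η.d + proj J 1 1 η.d := by
    have h := proj_sum_two J η.d
    rw [proj_zero_two_d_proj_one_zero hJ hs hγs, add_zero] at h
    exact h.symm
  have hsum : (proj J 2 0 η.d).d + (proj J 1 1 η.d).d = 0 := by
    rw [← CForm.d_add hκs hβs, ← hηd, hηs.d_d]
  have hκ := isClosed_of_d_add_d_eq_zero hJ hs hηs.d hηs.d hsum hdd
  have hγd : γ.d = η.d + (proj J 0 1 γ).d := by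
    rw [← CForm.d_add hηs hη', proj_sum_one]
  have h1 : proj J 2 0 γ.d = proj J 2 0 η.d := by
    rw [hγd, proj_add, proj_two_zero_d_proj_zero_one hJ hs hγs, add_zero]
  have hσ : σ = γ.d + (α₂₀ + α₁₁ + α₀₂) := by rw [hd, sub_add_cancel]
  have p20 : proj J 2 0 α₂₀ = α₂₀ := funext fun x => typePart_two_zero_of_isType (hα20 x)
  have p11 : proj J 2 0 α₁₁ = 0 :=
    funext fun x => typePart_eq_zero_of_isType (hα11 x) (by simp)
  have p02 : proj J 2 0 α₀₂ = 0 :=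
    funext fun x => typePart_eq_zero_of_isType (hα02 x) (by simp)
  have h2 : proj J 2 0 σ = proj J 2 0 η.d + α₂₀ := by
    rw [hσ, proj_add, proj_add, proj_add, h1, p20, p11, p02, add_zero, add_zero]
  rw [h2, CForm.IsClosed, CForm.d_add hκs hα, hκ, hαc, add_zero]

end Projections

/-! ### Non-degeneracy is open, uniformly over compact `M` -/

section Nondegenerate

variable {E : Type*} [NormedAddCommGroup E] [NormedSpace ℝ E]

/-- Non-degeneracy of an alternating bilinear form. -/
def IsNondegenerate (s : E [⋀^Fin 2]→L[ℝ] ℂ) : Prop := ∀ v, (∀ w, s ![v, w] = 0) → v = 0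

theorem isNondegenerate_compContinuousLinearMap {s : E [⋀^Fin 2]→L[ℝ] ℂ} {A B : E →L[ℝ] E}
    (hAB : ∀ v, A (B v) = v) (hBA : ∀ v, B (A v) = v) :
    IsNondegenerate (s.compContinuousLinearMap A) ↔ IsNondegenerate s := by
  have e (v w : E) : s.compContinuousLinearMap A ![v, w] = s ![A v, A w] := by
    rw [ContinuousAlternatingMap.compContinuousLinearMap_apply]
    congr 1
    ext i
    fin_cases i <;> rfl
  simp only [IsNondegenerate, e]
  constructor
  · intro h v hv
    rw [← hAB v, h (B v) fun w => by rw [hAB]; exact hv _, map_zero]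
  · intro h v hv
    have := h (A v) fun w => by rw [← hAB w]; exact hv _
    rw [← hBA v, this, map_zero]

/-- Non-degeneracy is injectivity of `v ↦ s(v, ·)`, and injective linear maps form an open set in
finite dimension. -/
theorem isOpen_setOf_isNondegenerate [FiniteDimensional ℝ E] :
    IsOpen {s : E [⋀^Fin 2]→L[ℝ] ℂ | IsNondegenerate s} := by
  let Φ : (E [⋀^Fin 2]→L[ℝ] ℂ) → E →L[ℝ] (ContinuousMultilinearMap ℝ (fun _ : Fin 1 => E) ℂ) :=
    fun s => s.toContinuousMultilinearMap.curryLeft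
  have hΦ : Continuous Φ := (continuousMultilinearCurryLeftEquiv ℝ
    (fun _ : Fin 2 => E) ℂ).continuous.comp
      (ContinuousAlternatingMap.toContinuousMultilinearMapCLM (𝕜 := ℝ) (E := E) (F := ℂ)
        (ι := Fin 2) ℝ).continuous
  have h := (ContinuousLinearMap.isOpen_injective (𝕜 := ℝ) (E := E)
    (F := ContinuousMultilinearMap ℝ (fun _ : Fin 1 => E) ℂ)).preimage hΦ
  convert h using 1
  ext s
  simp only [Set.mem_ofPred_eq, Set.mem_preimage, IsNondegenerate,
    injective_iff_map_eq_zero]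
  refine forall_congr' fun v => imp_congr_left ⟨fun hv => ?_, fun hv w => ?_⟩
  · ext w
    rw [vec_one_eq w]
    exact hv (w 0)
  · exact congrArg (fun L : ContinuousMultilinearMap ℝ (fun _ : Fin 1 => E) ℂ => L ![w]) hv

variable {M : Type*} [TopologicalSpace M] [ChartedSpace E M] [IsManifold 𝓘(ℝ, E) ∞ M]

theorem isNondegenerate_inChart_iff (σ : CForm E M 2) (x₀ : M) {z : M}
    (hz : z ∈ (chartAt E x₀).source) :
    IsNondegenerate (σ.inChart x₀ (chartAt E x₀ z)) ↔ IsNondegenerate (σ.val z) := by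
  rw [CForm.inChart_eq, (chartAt E x₀).left_inv hz]
  refine isNondegenerate_compContinuousLinearMap (B := dchart x₀ z)
    (fun v => dsymm_dchart x₀ hz v) fun v => ?_
  have h := dchart_dsymm x₀ ((chartAt E x₀).map_source hz) v
  rwa [(chartAt E x₀).left_inv hz] at h

variable [FiniteDimensional ℝ E]

/-- On a compact manifold, if the `(2,0)`-part of a form is non-degenerate for the parameter `0`,
then it is non-degenerate for all small parameters. -/
theorem eventually_isNondegenerate_proj [CompactSpace M] {ε : ℝ} (hε : 0 < ε)
    {J : ℝ → EndField E M} (hJ : IsDifferentiableFamily ε J) {σ : CForm E M 2}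
    (hσ : σ.IsSmooth) (h0 : ∀ x, IsNondegenerate ((proj (J 0) 2 0 σ).val x)) :
    ∀ᶠ t in 𝓝 (0 : ℝ), ∀ x, IsNondegenerate ((proj (J t) 2 0 σ).val x) := by
  -- Locally, the coordinate expression is continuous in the parameter and the point together;
  -- non-degeneracy does not depend on the chart, so the fixed chart at `x₀` serves for all nearby
  -- points.
  have key : ∀ x₀ : M, x₀ ∈ Set.univ → ∀ᶠ p : ℝ × M in 𝓝 ((0 : ℝ), x₀),
      IsNondegenerate ((proj (J p.1) 2 0 σ).val p.2) := by
    intro x₀ _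
    have hc : ContDiffOn ℝ ∞ (fun p : ℝ × E => typePart (endInChart (J p.1) x₀ p.2) 2 0
        (σ.inChart x₀ p.2)) (Set.Ioo (-ε) ε ×ˢ (chartAt E x₀).target) :=
      contDiffOn_typePart (contDiffOn_endInChart hJ.smooth x₀)
        ((hσ x₀).comp contDiffOn_snd fun p hp => hp.2) 2 0
    have hU : Set.Ioo (-ε) ε ×ˢ (chartAt E x₀).source ∈ 𝓝 ((0 : ℝ), x₀) :=
      prod_mem_nhds (Ioo_mem_nhds (by linarith) hε)
        ((chartAt E x₀).open_source.mem_nhds (mem_chart_source E x₀))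
    have hV : Set.Ioo (-ε) ε ×ˢ (chartAt E x₀).target ∈ 𝓝 ((0 : ℝ), chartAt E x₀ x₀) :=
      prod_mem_nhds (Ioo_mem_nhds (by linarith) hε)
        ((chartAt E x₀).open_target.mem_nhds (mem_chart_target E x₀))
    have h1 : ContinuousAt (fun p : ℝ × M => ((p.1, chartAt E x₀ p.2) : ℝ × E)) (0, x₀) :=
      continuousAt_fst.prodMk (((chartAt E x₀).continuousAt
        (mem_chart_source E x₀)).comp' continuousAt_snd)
    have h2 := ContinuousAt.comp' (x := ((0 : ℝ), x₀)) (hc.continuousOn.continuousAt hV) h1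
    have h3 (p : ℝ × M) (hp : p.2 ∈ (chartAt E x₀).source) :
        IsNondegenerate (typePart (endInChart (J p.1) x₀ (chartAt E x₀ p.2)) 2 0
          (σ.inChart x₀ (chartAt E x₀ p.2))) ↔
        IsNondegenerate ((proj (J p.1) 2 0 σ).val p.2) := by
      rw [← inChart_proj (J p.1) 2 0 σ x₀ ((chartAt E x₀).map_source hp)]
      exact isNondegenerate_inChart_iff _ x₀ hp
    have h4 := h2.eventually (isOpen_setOf_isNondegenerate.mem_nhds
      ((h3 (0, x₀) (mem_chart_source E x₀)).2 (h0 x₀)))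
    filter_upwards [h4, hU] with p hp hpU
    exact (h3 p hpU.2).1 hp
  -- Tube lemma: neighbourhoods of the points `(0, x₀)` contain a common strip around `{0} × M`.
  exact (isCompact_univ.eventually_forall_of_forall_eventually key).mono
    fun t ht x => ht x (Set.mem_univ x)

end Nondegenerate

end CplxSympl

end

/-! ### The stability theorem -/

theorem mainTheorem5 {E : Type*} [NormedAddCommGroup E] [NormedSpace ℝ E] [FiniteDimensional ℝ E]
    {M : Type*} [TopologicalSpace M] [T2Space M] [CompactSpace M] [ChartedSpace E M]
    [IsManifold 𝓘(ℝ, E) ∞ M]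
    (ε : ℝ) (hε : 0 < ε) (J : ℝ → CplxSympl.EndField E M)
    (hJ : CplxSympl.IsDifferentiableFamily ε J)
    (σ : CplxSympl.CForm E M 2) (hσ : CplxSympl.IsComplexSymplecticForm (J 0) σ)
    (hfull : ∀ t ∈ Set.Ioo (-ε) ε, t ≠ 0 → CplxSympl.IsComplexCInftyFull (J t) 2)
    (hγ : ∀ t ∈ Set.Ioo (-ε) ε, t ≠ 0 → ∃ γ ∈ CplxSympl.Delta (J t) σ,
      CplxSympl.del (J t) (CplxSympl.delbar (J t) (CplxSympl.proj (J t) 1 0 γ)) = 0) :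
    ∃ δ : ℝ, 0 < δ ∧ δ ≤ ε ∧ ∀ t ∈ Set.Ioo (-δ) δ,
      CplxSympl.IsComplexSymplectic (J t) ∧
        CplxSympl.IsComplexSymplecticForm (J t) (CplxSympl.proj (J t) 2 0 σ) := by
  have hproj0 : CplxSympl.proj (J 0) 2 0 σ = σ :=
    funext fun x => CplxSympl.typePart_two_zero_of_isType (hσ.isTypeForm.2 x)
  have hnd := CplxSympl.eventually_isNondegenerate_proj hε hJ hσ.isTypeForm.1
    (by rw [hproj0]; exact hσ.nondegenerate)
  obtain ⟨δ, hδ, hδ'⟩ := Metric.eventually_nhds_iff.1 hnd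
  -- The radius `δ` ensures non-degeneracy; the bound by `ε` keeps `J t` inside the family.
  refine ⟨min δ ε, lt_min hδ hε, min_le_right _ _, fun t ht => ?_⟩
  have htε : t ∈ Set.Ioo (-ε) ε :=
    ⟨by linarith [ht.1, min_le_right δ ε], ht.2.trans_le (min_le_right _ _)⟩
  have htδ : dist t 0 < δ := by
    rw [Real.dist_0_eq_abs, abs_lt]
    exact ⟨by linarith [ht.1, min_le_left δ ε], ht.2.trans_le (min_le_left _ _)⟩
  have hJt := hJ.isComplexStructure t htε
  have hs (x₀ : M) : ContDiffOn ℝ ∞ (CplxSympl.endInChart (J t) x₀) (chartAt E x₀).target :=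
    (CplxSympl.contDiffOn_endInChart hJ.smooth x₀).comp
      (contDiffOn_const.prodMk contDiffOn_id) fun y hy => ⟨htε, hy⟩
  have hmain : CplxSympl.IsComplexSymplecticForm (J t) (CplxSympl.proj (J t) 2 0 σ) := by
    refine ⟨⟨CplxSympl.isSmooth_proj hs hσ.isTypeForm.1 2 0, fun x =>
      CplxSympl.isType_typePart_two_zero (hJt.sq_eq x) (σ x)⟩, ?_, hδ' htδ⟩
    -- At `t = 0` no `γ` is given, but there the `(2,0)`-part is `σ` itself, which is closed.
    rcases eq_or_ne t 0 with rfl | ht0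
    · rw [hproj0]
      exact hσ.closed
    · obtain ⟨γ, hγ', hdd⟩ := hγ t htε ht0
      exact CplxSympl.isClosed_proj_two_zero hJt hs hγ' hdd
  exact ⟨⟨_, hmain⟩, hmain⟩
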